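/- (ZFC.) For $f,g\in{}^\omega\omega$ write $f\le g$ if $f(i)\le g(i)$ for all $i$, and $f\le^* g$ if $f(i)\le g(i)$ for all but finitely many $i$. Let $\mathfrak d$ be the least cardinality of a cofinal subset of $({}^\omega\omega,\le^*)$. For an abelian group $G$ and $f\in{}^\omega\omega$ put $A_f=\bigoplus_{i\in\omega}G^{f(i)}$, $B_f=\prod_{i\in\omega}G^{f(i)}$ and $Q_f=B_f/A_f$, where elements of $B_f$ are regarded as functions $I_f\to G$ on $I_f=\{(i,j)\mid j<f(i)\}$. Let $\mathbf A_G$ be the inverse system of the groups $A_f$ indexed by $({}^\omega\omega,\le)$, with the projections as bonding maps; $\lim^n$ is the $n$-th right derived functor of the inverse limit. For $f\le^* g$ the projection induces a map $p_f^g\colon Q_g\to Q_f$ (restriction of functions, modulo finite), so that the groups $Q_f$ form an inverse system indexed by $({}^\omega\omega,\le^*)$. For $n\ge 1$ and $P\subseteq{}^\omega\omega$, an $n$-family on $P$ is a family $x=(x_{f_0,\dots,f_{n-1}})$ with $x_{f_0,\dots,f_{n-1}}\in Q_{f_0}$, indexed by all $f_0\le^*\dots\le^* f_{n-1}$ in $P$.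 Its coboundary is the $(n+1)$-family $$(\delta x)_{f_0,\dots,f_n}=p_{f_0}^{f_1}(x_{f_1,\dots,f_n})+\sum_{i=1}^{n}(-1)^i x_{f_0,\dots,\widehat{f_i},\dots,f_n}.$$ The family $x$ is coherent if $\delta x=0$. For $n\ge2$ it is trivial if $x=\delta y$ for some $(n-1)$-family $y$ on $P$; for $n=1$ it is trivial if there is a function $\psi\colon\omega\times\omega\to G$ such that $x_f$ is the class of $\psi\restriction I_f$ for every $f\in P$. A set $C$ in a quasi-order is a $\kappa$-chain if there is a bijection $\sigma\colon\kappa\to C$ such that $\alpha\le\beta$ implies $\sigma(\alpha)\le\sigma(\beta)$. Let $S^k_{k+1}=\{\alpha<\omega_{k+1}\mid \operatorname{cof}(\alpha)=\omega_k\}$. For $S\subseteq\kappa$, the weak diamond $w\Diamond(S)$ says: for every $F\colon 2^{<\kappa}\to2$ there is $g\colon\kappa\to2$ such that for all $b\colon\kappa\to2$ the set $\{\alpha\in S\mid g(\alpha)=F(b\restriction\alpha)\}$ is stationary in $\kappa$. **Theorem.** Let $n\in\omega$, and suppose that $\mathfrak d=\aleph_n$ (so $n\geq 1$), that $C$ is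 an $\omega_n$-chain in $({}^\omega\omega,\le^*)$ that is unbounded in $({}^\omega\omega,\le^*)$, that $w\Diamond(S^k_{k+1})$ holds for all $k<n$, and that $2^{\aleph_0}<2^{\aleph_1}$. Then for every nontrivial abelian group $G$ there is a coherent $n$-family $x$ on ${}^\omega\omega$ for $G$ whose restriction to $C$ is not trivial. In particular, $\lim^n\mathbf A_G\ne0$. -/

import Mathlib

open CategoryTheory CategoryTheory.Limits Opposite
open scoped Cardinal Ordinal

universe u

namespace NonvanishingLim

/-! ### Derived functors of the inverse limit -/

section DerivedLimit

/-- The category of functors from a small category to abelian groups has enough injectives. -/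
instance enoughInjectives_functor (J : Type) [SmallCategory J] :
    EnoughInjectives (J ⥤ AddCommGrpCat.{u}) := by
  have hD : EnoughInjectives (Discrete J ⥤ AddCommGrpCat.{u}) := by
    refine ⟨fun F => ⟨⟨Discrete.functor fun j => Injective.under (F.obj ⟨j⟩), ⟨?_⟩,
      Discrete.natTrans fun j => Injective.ι (F.obj j), ?_⟩⟩⟩
    · intro X Y g f _
      refine ⟨Discrete.natTrans fun j => Injective.factorThru (J := Injective.under (F.obj j))
        (g.app j) (f.app j), ?_⟩
      ext1
      funext j
      exact Injective.comp_factorThru (J := Injective.under (F.obj j)) (g.app j) (f.app j)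
    · have : ∀ j, Mono ((Discrete.natTrans (F := F)
          (G := Discrete.functor fun j => Injective.under (F.obj ⟨j⟩))
          fun j => Injective.ι (F.obj j)).app j) := fun j =>
        inferInstanceAs (Mono (Injective.ι (F.obj j)))
      exact NatTrans.mono_of_mono_app _
  let L : Discrete J ⥤ J := Discrete.functor id
  have h2 : ((Functor.whiskeringLeft _ _ AddCommGrpCat.{u}).obj L).ReflectsMonomorphisms := by
    refine ⟨fun {X Y} f hf => ?_⟩
    have : ∀ j, Mono (f.app j) := fun j =>
      (NatTrans.mono_iff_mono_app
        (((Functor.whiskeringLeft _ _ AddCommGrpCat.{u}).obj L).map f)).1 hf ⟨j⟩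
    exact NatTrans.mono_of_mono_app _
  exact EnoughInjectives.of_adjunction (L.ranAdjunction AddCommGrpCat.{u})

instance lim_additive (J : Type) [SmallCategory J] :
    (lim : (J ⥤ AddCommGrpCat.{u}) ⥤ AddCommGrpCat.{u}).Additive where
  map_add {F G f g} := by
    apply limit.hom_ext
    intro j
    simp [Preadditive.add_comp, Preadditive.comp_add]

/-- `limⁿ F`: the `n`-th right derived functor of the inverse limit, at the inverse system `F`
of abelian groups indexed by the preorder `Λ`. -/
noncomputable def derivedLim {Λ : Type} [Preorder Λ] (n : ℕ) (F : Λᵒᵖ ⥤ AddCommGrpCat.{u}) :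
    AddCommGrpCat.{u} :=
  ((lim : (Λᵒᵖ ⥤ AddCommGrpCat.{u}) ⥤ AddCommGrpCat.{u}).rightDerived n).obj F

end DerivedLimit

/-! ### The Roos complex -/

section Roos

variable {Λ : Type} [Preorder Λ]

/-- The `n`-cochains: families `x` with `x (λ₀ ≤ ⋯ ≤ λₙ) ∈ F λ₀`. -/
abbrev RoosCochain (F : Λᵒᵖ ⥤ AddCommGrpCat.{u}) (n : ℕ) : Type u :=
  ∀ t : Fin (n + 1) →o Λ, F.obj (op (t 0))

/-- The tuple `t` with its `i`-th entry removed. -/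
def face {n : ℕ} (t : Fin (n + 2) →o Λ) (i : Fin (n + 2)) : Fin (n + 1) →o Λ :=
  t.comp (Fin.succAboveOrderEmb i).toOrderHom

theorem zero_le_face_zero {n : ℕ} (t : Fin (n + 2) →o Λ) (i : Fin (n + 2)) :
    t 0 ≤ face t i 0 :=
  t.monotone (Fin.zero_le _)

/-- The coboundary `(δ x)_t = ∑ᵢ (-1)ⁱ p (x_{tⁱ})`, where `p` is the bonding morphism to `F (t 0)`;
for `i > 0` the tuple `tⁱ` starts with `t 0` and `p` is the identity. -/
noncomputable def roosCoboundary (F : Λᵒᵖ ⥤ AddCommGrpCat.{u}) (n : ℕ) :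
    RoosCochain F n →+ RoosCochain F (n + 1) where
  toFun x t := ∑ i : Fin (n + 2),
    (-1 : ℤ) ^ (i : ℕ) • F.map (homOfLE (zero_le_face_zero t i)).op (x (face t i))
  map_zero' := by
    funext t
    simp
  map_add' x y := by
    funext t
    simp [Finset.sum_add_distrib]

end Roos

/-! ### The index orders -/

/-- `ω^ω` with everywhere domination: `f ≤ g` iff `f i ≤ g i` for all `i`. -/
def Baire : Type := ℕ → ℕ

instance : Preorder Baire := inferInstanceAs (Preorder (ℕ → ℕ))

/-- `ω^ω` with eventual domination `≤*`: `f ≤* g` iff `f i ≤ g i` for all but finitely many `i`. -/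
def BaireMod : Type := ℕ → ℕ

instance instPreorderBaireMod : Preorder BaireMod where
  le f g := {i : ℕ | ¬ f i ≤ g i}.Finite
  le_refl f := by simp
  le_trans f g h hfg hgh := by
    refine (hfg.union hgh).subset fun i hi => ?_
    by_contra hc
    simp only [Set.mem_union, Set.mem_ofPred_eq, not_or, not_not] at hc
    exact hi (hc.1.trans hc.2)

/-- The dominating number `𝔡`: the least cardinality of a cofinal subset of `(ω^ω, ≤*)`. -/
noncomputable def dominatingNumber : Cardinal.{0} := Order.cof BaireMod

/-- `C` is a `κ`-chain of the preorder `P`: there is a monotone bijective enumeration of `C`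
by the ordinals below `κ`. -/
def IsOrdinalChain {P : Type} [Preorder P] (κ : Ordinal.{0}) (C : Set P) : Prop :=
  ∃ σ : Set.Iio κ ≃ C, ∀ α β : Set.Iio κ, α ≤ β → (σ α : P) ≤ (σ β : P)

/-! ### The inverse systems -/

section Systems

variable (G : Type u) [AddCommGroup G]

/-- The points `(i, j)` with `j < f i`, so that `G ^ Region f = ∏ᵢ G^(f i)`. -/
def Region (f : ℕ → ℕ) : Type := {p : ℕ × ℕ // p.2 < f p.1}

/-- `B_f = ∏ᵢ G^(f i)`. -/
abbrev BGroup (f : ℕ → ℕ) : Type u := Region f → G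

/-- `A_f = ⨁ᵢ G^(f i)`, as the subgroup of finitely supported elements of `B_f`. -/
def AGroup (f : ℕ → ℕ) : AddSubgroup (BGroup G f) where
  carrier := {x | (Function.support x).Finite}
  zero_mem' := by simp
  add_mem' {x y} hx hy := (hx.union hy).subset (Function.support_add x y)
  neg_mem' {x} hx := by simpa using hx

/-- The projection `B_g → B_f`: restriction to the points of `Region f` that lie in `Region g`,
with value `0` at the other points of `Region f` (there are none if `f ≤ g`, and finitely many
if `f ≤* g`). -/
def restrictB (f g : ℕ → ℕ) : BGroup G g →+ BGroup G f where
  toFun x p := if h : p.1.2 < g p.1.1 then x ⟨p.1, h⟩ else 0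
  map_zero' := by
    funext p
    exact ite_self _
  map_add' x y := by
    funext p
    by_cases h : p.1.2 < g p.1.1
    · simp only [h, dif_pos, Pi.add_apply]
      rfl
    · simp only [h, dif_neg, not_false_eq_true, Pi.add_apply, add_zero]

theorem restrictB_mem (f g : ℕ → ℕ) {x : BGroup G g} (hx : x ∈ AGroup G g) :
    restrictB G f g x ∈ AGroup G f := by
  have hx' : (Function.support x).Finite := hx
  refine Set.Finite.of_finite_image (f := Subtype.val)
    ((hx'.image Subtype.val).subset ?_) Subtype.val_injective.injOn
  rintro _ ⟨p, hp, rfl⟩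
  by_cases h : p.1.2 < g p.1.1
  · refine ⟨⟨p.1, h⟩, ?_, rfl⟩
    have hp' : restrictB G f g x p ≠ 0 := hp
    have e : restrictB G f g x p = x ⟨p.1, h⟩ := dif_pos h
    exact fun h0 => hp' (e.trans h0)
  · exact absurd (show restrictB G f g x p = 0 from dif_neg h) hp

/-- The inverse system `𝐀_G` on `(ω^ω, ≤)`. -/
def ASystem : Baireᵒᵖ ⥤ AddCommGrpCat.{u} where
  obj f := AddCommGrpCat.of (AGroup G f.unop)
  map {g f} _ := AddCommGrpCat.ofHom
    (((restrictB G f.unop g.unop).comp (AGroup G g.unop).subtype).codRestrict (AGroup G f.unop)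
      fun x => restrictB_mem G f.unop g.unop x.2)
  map_id f := by
    refine AddCommGrpCat.hom_ext (AddMonoidHom.ext fun x => Subtype.ext ?_)
    funext p
    exact dif_pos p.2
  map_comp {h g f} u v := by
    refine AddCommGrpCat.hom_ext (AddMonoidHom.ext fun x => Subtype.ext ?_)
    funext p
    have hp : p.1.2 < g.unop p.1.1 := p.2.trans_le (leOfHom v.unop p.1.1)
    change (if h : _ then _ else _) = (if h : _ then (if h : _ then _ else _) else _)
    rw [dif_pos hp]

/-- `Q_f = B_f / A_f`. -/
abbrev QGroup (f : ℕ → ℕ) : Type u := BGroup G f ⧸ AGroup G f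

/-- The map `Q_g → Q_f` induced by the projection `B_g → B_f`. -/
def restrictQ (f g : ℕ → ℕ) : QGroup G g →+ QGroup G f :=
  QuotientAddGroup.map _ _ (restrictB G f g) fun _ hx => restrictB_mem G f g hx

theorem finite_region_diff {f g : BaireMod} (h : f ≤ g) :
    {p : Region f | ¬ p.1.2 < g p.1.1}.Finite := by
  have h' : {i : ℕ | ¬ f i ≤ g i}.Finite := h
  refine Set.Finite.of_finite_image (f := Subtype.val) ?_ Subtype.val_injective.injOn
  refine (h'.biUnion fun i _ => (Set.finite_singleton i).prod (Set.finite_Iio (f i))).subset ?_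
  rintro _ ⟨p, hp, rfl⟩
  have hp' : ¬ p.1.2 < g p.1.1 := hp
  have h2 := p.2
  simp only [Set.mem_iUnion, Set.mem_ofPred_eq, Set.mem_prod, Set.mem_singleton_iff, Set.mem_Iio]
  exact ⟨p.1.1, by omega, rfl, h2⟩

/-- The inverse system `(𝐁_G / 𝐀_G)_{≤*}` on `(ω^ω, ≤*)`. -/
def QSystem : BaireModᵒᵖ ⥤ AddCommGrpCat.{u} where
  obj f := AddCommGrpCat.of (QGroup G f.unop)
  map {g f} _ := AddCommGrpCat.ofHom (restrictQ G f.unop g.unop)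
  map_id f := by
    refine AddCommGrpCat.hom_ext (AddMonoidHom.ext fun x => ?_)
    obtain ⟨x, rfl⟩ := QuotientAddGroup.mk_surjective x
    refine congrArg QuotientAddGroup.mk ?_
    funext p
    exact dif_pos p.2
  map_comp {h g f} u v := by
    refine AddCommGrpCat.hom_ext (AddMonoidHom.ext fun x => ?_)
    obtain ⟨x, rfl⟩ := QuotientAddGroup.mk_surjective x
    refine QuotientAddGroup.eq.2 ?_
    refine (finite_region_diff (leOfHom v.unop)).subset fun p hp => ?_
    by_contra hc
    have hp2 : p.1.2 < g.unop p.1.1 := not_not.1 hc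
    refine hp ?_
    have : restrictB G f.unop g.unop (restrictB G g.unop h.unop x) p
        = restrictB G f.unop h.unop x p := by
      change (if h : _ then (if h : _ then _ else _) else _) = (if h : _ then _ else _)
      rw [dif_pos hp2]
    change - restrictB G f.unop h.unop x p +
      restrictB G f.unop g.unop (restrictB G g.unop h.unop x) p = 0
    rw [this, neg_add_cancel]

/-- The restriction of `(𝐁_G / 𝐀_G)_{≤*}` to `P ⊆ ω^ω`. -/
abbrev QSystemOn (P : Set BaireMod) : (↥P)ᵒᵖ ⥤ AddCommGrpCat.{u} :=
  (Subtype.mono_coe (· ∈ P)).functor.op ⋙ QSystem G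

/-! ### Coherent and trivial families

For `n ≥ 1` an `n`-family on `P` is an `(n - 1)`-cochain of the Roos complex of
`(𝐁_G / 𝐀_G)_{≤*}` restricted to `P`, that is, a family of functions modulo finite indexed by
the `≤*`-increasing `n`-tuples of `P`. A family indexed by `0`-tuples is a single function on
`ω × ω`. -/

/-- The `n`-families on `P` for the group `G`. -/
def Family (P : Set BaireMod) : ℕ → Type u
  | 0 => ℕ × ℕ → G
  | n + 1 => RoosCochain (QSystemOn G P) n

instance (P : Set BaireMod) : ∀ n, AddCommGroup (Family G P n)
  | 0 => inferInstanceAs (AddCommGroup (ℕ × ℕ → G))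
  | n + 1 => inferInstanceAs (AddCommGroup (RoosCochain (QSystemOn G P) n))

/-- The coboundary from `n`-families to `(n + 1)`-families. For `n = 0` it sends `ψ` to the classes
of the restrictions `ψ ↾ Region f`. -/
noncomputable def coboundary (P : Set BaireMod) :
    ∀ n, Family G P n → Family G P (n + 1)
  | 0, ψ => fun t => (QuotientAddGroup.mk fun p => ψ p.1 : QGroup G (t 0).1)
  | n + 1, x => roosCoboundary (QSystemOn G P) n x

variable {G}

/-- The family `x` is coherent. -/
def IsCoherent {P : Set BaireMod} {n : ℕ} (x : Family G P n) : Prop :=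
  coboundary G P n x = 0

/-- The family `x` is trivial. -/
def IsTrivial {P : Set BaireMod} : ∀ {n : ℕ}, Family G P n → Prop
  | 0, x => x = 0
  | n + 1, x => ∃ y : Family G P n, coboundary G P n y = x

/-- The restriction to `C` of a family on `P ⊇ C`. -/
def restrict {P C : Set BaireMod} (h : C ⊆ P) : ∀ {n : ℕ}, Family G P n → Family G C n
  | 0, ψ => ψ
  | _ + 1, x => fun t => x ((⟨Set.inclusion h, fun _ _ hab => hab⟩ : ↥C →o ↥P).comp t)

end Systems

/-! ### Weak diamonds -/

/-- The set `S^k_{k+1}` of the ordinals below `ω_{k+1}` of cofinality `ω_k`. -/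
def cofSet (k : ℕ) : Set (Set.Iio (ω_ ((k : Ordinal.{0}) + 1))) :=
  {α | Ordinal.cof α.1 = ℵ_ (k : Ordinal.{0})}

/-- The weak diamond `w◇(S)`, for a set `S` of elements of the well-order `W` (an initial ordinal
`κ`): for every `F : 2^{<κ} → 2` there is `g : κ → 2` such that for all `b : κ → 2` the set
`{α ∈ S | g α = F (b ↾ α)}` is stationary. -/
def WeakDiamond {W : Type*} [LinearOrder W] (S : Set W) : Prop :=
  ∀ F : (∀ α : W, (Set.Iio α → Bool) → Bool), ∃ g : W → Bool, ∀ b : W → Bool,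
    IsStationary {α : W | α ∈ S ∧ g α = F α fun β => b β.1}

end NonvanishingLim

namespace NonvanishingLim

/-! ### Alternating coboundaries of cochains on plain tuples -/

section Cochain

/-! Put `n = m + 1`; the case `n = 0` is void because `𝔡` is uncountable. Classes modulo finite are
replaced by functions on `ℕ × ℕ`, families by cochains on plain tuples, and equality in `Q_f` by
`EqMod`.

There is a positive and a negative half. Positive (`triv_ideal`): a coherent `(n + 1)`-family is
trivial on an ideal with at most `ℵ_k` generators when `k ≤ n`. Trivializations are extended along a
filtration of the ideal, and the obstruction to an extension is a coherent family one degree lower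
on fewer generators.

Negative (`nonvanishing`): on an ideal with `ℵ_{m+1}` generators a coherent `(m + 1)`-family is
built along a filtration of length `ω_{m+1}`. At stage `α` the family built so far is trivial by the
positive half, say `δY`, and can be continued either by `δY` or by `δY + z_α`. Here `z_α` is the
cone `(t, u) ↦ w t` over a coherent `m`-family `w` on the part below `α`, nontrivial on a test set.
A trivialization of the result, restricted below `α`, extends over `u` for at most one of the two
choices, since the difference of two extensions would trivialize `w`. The weak diamond on points of
cofinality `ω_m` guesses whether it extends for `δY`, and the construction makes the other choice.
Such `w` come from induction on `m`, applied to a cofinal sequence of length `ω_m` in `α`; for `m =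
0`, `w` is a single function that is null below every member of a countably generated ideal but not
below `u`.

The weak diamond can only predict few bits, so triviality is refuted after applying a nonzero
character `φ : G → ℚ/ℤ`, whose target is countable.

The test sets come from the unbounded chain, for two orders `r`. With `≤*` and singletons the family
is nontrivial on `C`. With everywhere domination and the countable classes modulo finite of the
chain members, it is nontrivial for `≤`. The latter gives `limⁿ 𝐀_G ≠ 0`: exactness of the Roos
complex of `𝐀_G` would trivialize the family for `≤` (`exists_eqMod_of_roos_exact`), and vanishing
of the derived limit implies that exactness (`roos_exact_of_isZero_derivedLim`). -/

theorem sum_sum_eq_zero_of_swap {A : Type*} [AddCommGroup A] {n : ℕ}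
    (f : Fin (n + 2) → Fin (n + 1) → A)
    (hf : ∀ i j, f (i.succAbove j) (j.predAbove i) = f i j) :
    ∑ i : Fin (n + 2), (-1 : ℤ) ^ (i : ℕ) • ∑ j : Fin (n + 1), (-1 : ℤ) ^ (j : ℕ) • f i j = 0 := by
  simp only [Finset.smul_sum, smul_smul, ← pow_add]
  rw [← Finset.sum_product' (f := fun (i : Fin (n + 2)) (j : Fin (n + 1)) =>
    (-1 : ℤ) ^ ((i : ℕ) + (j : ℕ)) • f i j)]
  refine Finset.sum_involution (fun p _ => (p.1.succAbove p.2, p.2.predAbove p.1)) ?_ ?_ ?_ ?_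
  · rintro ⟨i, j⟩ -
    simp only [hf, Fin.neg_one_pow_succAbove_add_predAbove, neg_smul]
    exact add_neg_cancel _
  · rintro ⟨i, j⟩ - - h
    exact Fin.succAbove_ne i j (congrArg Prod.fst h)
  · simp
  · rintro ⟨i, j⟩ -
    simp [Fin.succAbove_succAbove_predAbove, Fin.predAbove_predAbove_succAbove]

variable {B H : Type*} [AddCommGroup H] {n : ℕ}

/-- The alternating sum of a cochain over the faces of a tuple. -/
def dl {B H : Type*} [AddCommGroup H] {n : ℕ} :
    ((Fin n → B) → H) →+ ((Fin (n + 1) → B) → H) where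
  toFun x t := ∑ i : Fin (n + 1), (-1 : ℤ) ^ (i : ℕ) • x (t ∘ i.succAbove)
  map_zero' := by
    funext t
    simp
  map_add' x y := by
    funext t
    simp [Finset.sum_add_distrib]

theorem dl_apply (x : (Fin n → B) → H) (t : Fin (n + 1) → B) :
    dl x t = ∑ i : Fin (n + 1), (-1 : ℤ) ^ (i : ℕ) • x (t ∘ i.succAbove) := rfl

theorem dl_dl (x : (Fin n → B) → H) : dl (dl x) = 0 := by
  funext t
  refine sum_sum_eq_zero_of_swap (fun i j => x ((t ∘ i.succAbove) ∘ j.succAbove)) fun i j => ?_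
  congr 1
  funext k
  simp [Fin.succAbove_succAbove_succAbove_predAbove]

theorem dl_snoc (x : (Fin (n + 1) → B) → H) (t : Fin (n + 1) → B) (d : B) :
    dl x (Fin.snoc t d) =
      dl (fun s : Fin n → B => x (Fin.snoc s d)) t + (-1 : ℤ) ^ (n + 1) • x t := by
  rw [dl_apply, Fin.sum_univ_castSucc, dl_apply]
  congr 1
  · refine Finset.sum_congr rfl fun i _ => ?_
    congr 2
    funext k
    refine Fin.lastCases ?_ (fun k => ?_) k
    · simp
    · simp [Fin.castSucc_succAbove_castSucc]
  · simp only [Fin.val_last]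
    congr 2
    funext k
    simp

theorem dl_cons (x : (Fin (n + 1) → B) → H) (t : Fin (n + 1) → B) (d : B) :
    dl x (Fin.cons d t) = x t - dl (fun s : Fin n → B => x (Fin.cons d s)) t := by
  rw [dl_apply, Fin.sum_univ_succ, dl_apply, sub_eq_add_neg, ← Finset.sum_neg_distrib]
  congr 1
  · simp only [Fin.val_zero, pow_zero, one_smul]
    congr 1
  · refine Finset.sum_congr rfl fun i _ => ?_
    rw [Fin.val_succ, pow_succ, mul_neg_one, neg_smul]
    congr 3
    funext k
    refine Fin.cases ?_ (fun k => ?_) k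
    · simp
    · simp

theorem dl_map {H' : Type*} [AddCommGroup H'] (φ : H →+ H') (x : (Fin n → B) → H)
    (t : Fin (n + 1) → B) : φ (dl x t) = dl (fun s => φ (x s)) t := by
  simp [dl_apply, map_sum, map_zsmul]

end Cochain

/-! ### Cochains modulo finite -/

section EqMod

/-- The functions that vanish at all but finitely many points below the graph of `f`. -/
def null (G : Type*) [AddCommGroup G] (f : BaireMod) : AddSubgroup (ℕ × ℕ → G) where
  carrier := {h | {p : ℕ × ℕ | p.2 < f p.1 ∧ h p ≠ 0}.Finite}
  zero_mem' := by simp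
  add_mem' {x y} hx hy := by
    refine (hx.union hy).subset ?_
    rintro p ⟨h1, h2⟩
    by_contra hc
    simp only [Set.mem_union, Set.mem_ofPred_eq, not_or, not_and, not_not] at hc
    exact h2 (by simp [hc.1 h1, hc.2 h1])
  neg_mem' {x} hx := by simpa using hx

/-- The `n`-cochains on `ω^ω` whose values are functions on `ω × ω`. -/
abbrev Coch (G : Type*) (n : ℕ) : Type _ := (Fin n → BaireMod) → ℕ × ℕ → G

variable {G : Type*} [AddCommGroup G] {n : ℕ} {r : BaireMod → BaireMod → Prop} {R R' : Set BaireMod}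

theorem mem_null {f : BaireMod} {h : ℕ × ℕ → G} :
    h ∈ null G f ↔ {p : ℕ × ℕ | p.2 < f p.1 ∧ h p ≠ 0}.Finite := Iff.rfl

theorem finite_below_diff {f g : BaireMod} (h : f ≤ g) :
    {p : ℕ × ℕ | p.2 < f p.1 ∧ ¬ p.2 < g p.1}.Finite := by
  have h' : {i : ℕ | ¬ f i ≤ g i}.Finite := h
  refine (h'.biUnion fun i _ => (Set.finite_singleton i).prod (Set.finite_Iio (f i))).subset ?_
  rintro p ⟨hp, hp'⟩
  simp only [Set.mem_iUnion, Set.mem_ofPred_eq, Set.mem_prod, Set.mem_singleton_iff, Set.mem_Iio]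
  exact ⟨p.1, by omega, rfl, hp⟩

theorem null_anti {f g : BaireMod} (h : f ≤ g) : null G g ≤ null G f := by
  intro x hx
  refine ((mem_null.1 hx).union (finite_below_diff h)).subset ?_
  rintro p ⟨h1, h2⟩
  by_cases hp : p.2 < g p.1
  · exact Or.inl ⟨hp, h2⟩
  · exact Or.inr ⟨h1, hp⟩

/-- The tuples of elements of `R` that are increasing for the relation `r`. -/
def Tup (r : BaireMod → BaireMod → Prop) (R : Set BaireMod) {n : ℕ} (t : Fin n → BaireMod) : Prop :=
  (∀ i, t i ∈ R) ∧ ∀ i j, i ≤ j → r (t i) (t j)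

theorem Tup.mono {t : Fin n → BaireMod} (h : Tup r R t) (hR : R ⊆ R') : Tup r R' t :=
  ⟨fun i => hR (h.1 i), h.2⟩

theorem Tup.imp {r' : BaireMod → BaireMod → Prop} {t : Fin n → BaireMod} (h : Tup r R t)
    (hr : ∀ f g, r f g → r' f g) : Tup r' R t :=
  ⟨h.1, fun i j hij => hr _ _ (h.2 i j hij)⟩

theorem Tup.face {t : Fin (n + 1) → BaireMod} (h : Tup r R t) (i : Fin (n + 1)) :
    Tup r R (t ∘ i.succAbove) :=
  ⟨fun _ => h.1 _, fun _ _ hij => h.2 _ _ ((Fin.strictMono_succAbove i).monotone hij)⟩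

theorem Tup.snoc {t : Fin n → BaireMod} (h : Tup r R t) {d : BaireMod} (hd : d ∈ R) (hdd : r d d)
    (htd : ∀ i, r (t i) d) : Tup r R (Fin.snoc t d : Fin (n + 1) → BaireMod) := by
  constructor
  · intro i
    refine Fin.lastCases ?_ (fun i => ?_) i
    · simpa using hd
    · simpa using h.1 i
  · intro i j
    refine Fin.lastCases ?_ (fun j => ?_) j <;> refine Fin.lastCases ?_ (fun i => ?_) i
    · simpa using hdd
    · intro _
      simpa using htd i
    · intro hij
      exact absurd (Fin.castSucc_lt_last j) hij.not_gt
    · intro hij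
      simpa using h.2 i j hij

/-- The cochains `x` and `y` agree modulo finite on all `r`-increasing tuples of `R`. -/
def EqMod (r : BaireMod → BaireMod → Prop) (R : Set BaireMod) (x y : Coch G (n + 1)) : Prop :=
  ∀ t : Fin (n + 1) → BaireMod, Tup r R t → x t - y t ∈ null G (t 0)

namespace EqMod

variable {x y z x' y' : Coch G (n + 1)}

theorem refl (x : Coch G (n + 1)) : EqMod r R x x := fun t _ => by
  rw [sub_self]
  exact zero_mem _

theorem symm (h : EqMod r R x y) : EqMod r R y x := fun t ht => by
  rw [← neg_sub]
  exact neg_mem (h t ht)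

theorem trans (h : EqMod r R x y) (h' : EqMod r R y z) : EqMod r R x z := fun t ht => by
  rw [← sub_add_sub_cancel (x t) (y t) (z t)]
  exact add_mem (h t ht) (h' t ht)

theorem add (h : EqMod r R x y) (h' : EqMod r R x' y') : EqMod r R (x + x') (y + y') :=
  fun t ht => by
    rw [Pi.add_apply, Pi.add_apply, add_sub_add_comm]
    exact add_mem (h t ht) (h' t ht)

theorem sub (h : EqMod r R x y) (h' : EqMod r R x' y') : EqMod r R (x - x') (y - y') :=
  fun t ht => by
    rw [Pi.sub_apply, Pi.sub_apply, sub_sub_sub_comm]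
    exact sub_mem (h t ht) (h' t ht)

theorem mono (h : EqMod r R x y) (hR : R' ⊆ R) : EqMod r R' x y := fun t ht => h t (ht.mono hR)

theorem dl (hr : ∀ f g, r f g → f ≤ g) (h : EqMod r R x y) :
    EqMod r R (dl x) (NonvanishingLim.dl y) := by
  intro t ht
  have e : NonvanishingLim.dl x t - NonvanishingLim.dl y t =
      NonvanishingLim.dl (x - y) t := by rw [map_sub]; rfl
  rw [e, dl_apply]
  refine sum_mem fun i _ => zsmul_mem ?_ _
  exact null_anti (hr _ _ (ht.2 0 (i.succAbove 0) (Fin.zero_le _))) (h _ (ht.face i))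

end EqMod

/-- Every coherent `(n + 1)`-family on `R` is trivial. -/
def Triv (G : Type*) [AddCommGroup G] (n : ℕ) (R : Set BaireMod) : Prop :=
  ∀ x : Coch G (n + 1), EqMod (· ≤ ·) R (dl x) 0 → ∃ y : Coch G n, EqMod (· ≤ ·) R x (dl y)

theorem triv_empty : Triv G n (∅ : Set BaireMod) := fun _ _ => ⟨0, fun _ ht => (ht.1 0).elim⟩

/-- Appending the greatest element `d` to tuples is a contracting homotopy: by `dl_snoc`, coherence
at `(t, d)` expresses `x t` as a coboundary up to sign. -/
theorem triv_of_isGreatest {d : BaireMod} (hd : d ∈ R) (h : ∀ p ∈ R, p ≤ d) : Triv G n R := by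
  intro x hx
  refine ⟨(-1 : ℤ) ^ n • fun s => x (Fin.snoc s d), fun t ht => ?_⟩
  have h1 := hx (Fin.snoc t d) (ht.snoc hd le_rfl fun i => h _ (ht.1 i))
  have e0 : (Fin.snoc t d : Fin (n + 2) → BaireMod) 0 = t 0 := Fin.snoc_castSucc _ _ (0 : Fin (n + 1))
  rw [dl_snoc, e0, Pi.zero_apply, sub_zero] at h1
  have h2 := neg_mem (zsmul_mem h1 ((-1 : ℤ) ^ n))
  convert h2 using 1
  rw [map_zsmul, Pi.smul_apply, smul_add, smul_smul, ← pow_add, neg_add]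
  have : (-1 : ℤ) ^ (n + (n + 1)) = -1 := by
    rw [← add_assoc, ← two_mul, pow_succ, pow_mul]
    simp
  rw [this]
  simp only [neg_smul, one_smul, neg_neg]
  abel

/-- Any trivialization `y'` on `R'` differs from `u` on `R` by a coherent family of one degree less.
If that difference is `δv` on `R`, then `y' - δv` agrees with `u` there and has the same coboundary
as `y'`. -/
theorem exists_extension (h' : Triv G (n + 1) R') (h : Triv G n R) (hR : R ⊆ R')
    {x : Coch G (n + 2)} (hx : EqMod (· ≤ ·) R' (dl x) 0) {u : Coch G (n + 1)}
    (hu : EqMod (· ≤ ·) R (dl u) x) :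
    ∃ y : Coch G (n + 1), EqMod (· ≤ ·) R y u ∧ EqMod (· ≤ ·) R' (dl y) x := by
  obtain ⟨y', hy'⟩ := h' x hx
  obtain ⟨v, hv⟩ := h (y' - u) (by
    rw [map_sub, ← sub_self x]
    exact (hy'.symm.mono hR).sub hu)
  refine ⟨y' - dl v, ?_, ?_⟩
  · have := (EqMod.refl y').sub hv.symm
    rwa [sub_sub_cancel] at this
  · rw [map_sub, dl_dl, sub_zero]
    exact hy'.symm

end EqMod

/-! ### Recursive constructions of cochains along a filtration -/

section Glue

variable {G : Type*} [AddCommGroup G] {n : ℕ} {W : Type*} [LinearOrder W] [WellFoundedLT W]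

open Classical in
/-- The cochain that takes at `t` the value of `X β`, for the least `β ∈ I` such that `t` is a
tuple of `R β`. -/
noncomputable def glue (R : W → Set BaireMod) (X : W → Coch G n) (I : Set W) : Coch G n := fun t =>
  if h : {β | β ∈ I ∧ ∀ i, t i ∈ R β}.Nonempty then X (wellFounded_lt.min _ h) t else 0

theorem glue_congr (R : W → Set BaireMod) {X X' : W → Coch G n} {I : Set W}
    (h : ∀ β ∈ I, X β = X' β) : glue R X I = glue R X' I := by
  funext t
  by_cases ht : {β | β ∈ I ∧ ∀ i, t i ∈ R β}.Nonempty
  · rw [glue, glue, dif_pos ht, dif_pos ht, h _ (wellFounded_lt.min_mem _ ht).1]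
  · rw [glue, glue, dif_neg ht, dif_neg ht]

theorem glue_eqMod {R : W → Set BaireMod} {X : W → Coch G (n + 1)} {I : Set W}
    (h : ∀ β ∈ I, ∀ γ ∈ I, γ < β → EqMod (· ≤ ·) (R γ) (X β) (X γ)) {β : W} (hβ : β ∈ I) :
    EqMod (· ≤ ·) (R β) (glue R X I) (X β) := by
  intro t ht
  have hne : {β | β ∈ I ∧ ∀ i, t i ∈ R β}.Nonempty := ⟨β, hβ, ht.1⟩
  have hm := wellFounded_lt.min_mem _ hne
  have hle : wellFounded_lt.min _ hne ≤ β := not_lt.1 (wellFounded_lt.not_lt_min _ (show β ∈ {β | β ∈ I ∧ ∀ i, t i ∈ R β} from ⟨hβ, ht.1⟩))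
  rw [glue, dif_pos hne]
  rcases hle.eq_or_lt with e | hlt
  · rw [e, sub_self]
    exact zero_mem _
  · exact (h β hβ _ hm.1 hlt).symm t ⟨hm.2, ht.2⟩

open Classical in
/-- The cochains obtained by applying at each stage `α` the operation `Φ α` to the cochain glued
from the earlier stages. -/
noncomputable def stage (R : W → Set BaireMod) (Φ : W → Coch G n → Coch G n) : W → Coch G n :=
  wellFounded_lt.fix fun α ih =>
    Φ α (glue R (fun β => if h : β < α then ih β h else 0) (Set.Iio α))

theorem stage_eq (R : W → Set BaireMod) (Φ : W → Coch G n → Coch G n) (α : W) :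
    stage R Φ α = Φ α (glue R (stage R Φ) (Set.Iio α)) := by
  rw [stage, WellFounded.fix_eq]
  congr 1
  refine glue_congr R fun β hβ => ?_
  exact dif_pos hβ

/-- This locality is what lets a guess at `α` depend only on the choices made below `α`. -/
theorem glue_stage_congr (R : W → Set BaireMod) {Φ Φ' : W → Coch G n → Coch G n} (α : W)
    (h : ∀ β < α, Φ β = Φ' β) :
    glue R (stage R Φ) (Set.Iio α) = glue R (stage R Φ') (Set.Iio α) := by
  refine glue_congr R fun β hβ => ?_
  induction β using WellFoundedLT.induction with
  | ind β ih =>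
    rw [stage_eq, stage_eq, h β hβ]
    exact congrArg _ (glue_congr R fun γ hγ => ih γ hγ (lt_trans hγ hβ))

/-- The last entry of an increasing tuple dominates the others, so the piece containing it contains
the whole tuple. -/
theorem exists_forall_mem {W : Type*} {R : W → Set BaireMod} (hlow : ∀ α, IsLowerSet (R α)) {I : Set W}
    {t : Fin (n + 1) → BaireMod} (ht : Tup (· ≤ ·) (⋃ β ∈ I, R β) t) :
    ∃ β ∈ I, Tup (· ≤ ·) (R β) t := by
  have h := ht.1 (Fin.last n)
  simp only [Set.mem_iUnion] at h
  obtain ⟨β, hβ, h⟩ := h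
  exact ⟨β, hβ, fun i => hlow β (ht.2 i _ (Fin.le_last i)) h, ht.2⟩

theorem dl_glue_eqMod {R : W → Set BaireMod} (hlow : ∀ α, IsLowerSet (R α))
    {X : W → Coch G (n + 1)} {I : Set W}
    (h : ∀ β ∈ I, ∀ γ ∈ I, γ < β → EqMod (· ≤ ·) (R γ) (X β) (X γ)) {x : Coch G (n + 2)}
    (hx : ∀ β ∈ I, EqMod (· ≤ ·) (R β) (dl (X β)) x) :
    EqMod (· ≤ ·) (⋃ β ∈ I, R β) (dl (glue R X I)) x := by
  intro t ht
  obtain ⟨β, hβ, htβ⟩ := exists_forall_mem hlow ht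
  exact (((glue_eqMod h hβ).dl fun _ _ h => h).trans (hx β hβ)) t htβ

theorem stage_spec {R : W → Set BaireMod} (hlow : ∀ α, IsLowerSet (R α))
    {Φ : W → Coch G (n + 1) → Coch G (n + 1)} {x : Coch G (n + 2)}
    (hΦ : ∀ α u, EqMod (· ≤ ·) (⋃ β ∈ Set.Iio α, R β) (dl u) x →
      EqMod (· ≤ ·) (⋃ β ∈ Set.Iio α, R β) (Φ α u) u ∧ EqMod (· ≤ ·) (R α) (dl (Φ α u)) x) (α : W) :
    (∀ β < α, EqMod (· ≤ ·) (R β) (stage R Φ α) (stage R Φ β)) ∧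
      EqMod (· ≤ ·) (R α) (dl (stage R Φ α)) x := by
  induction α using WellFoundedLT.induction with
  | ind α ih =>
    have h1 : ∀ β ∈ Set.Iio α, ∀ γ ∈ Set.Iio α, γ < β →
        EqMod (· ≤ ·) (R γ) (stage R Φ β) (stage R Φ γ) := fun β hβ γ _ hγ => (ih β hβ).1 γ hγ
    have h2 := hΦ α _ (dl_glue_eqMod hlow h1 fun β hβ => (ih β hβ).2)
    rw [stage_eq]
    refine ⟨fun β hβ => ?_, h2.2⟩
    exact (h2.1.mono (Set.subset_biUnion_of_mem (u := R) hβ)).trans (glue_eqMod h1 hβ)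

theorem dl_glue_stage {R : W → Set BaireMod} (hlow : ∀ α, IsLowerSet (R α))
    {Φ : W → Coch G (n + 1) → Coch G (n + 1)} {x : Coch G (n + 2)}
    (hΦ : ∀ α u, EqMod (· ≤ ·) (⋃ β ∈ Set.Iio α, R β) (dl u) x →
      EqMod (· ≤ ·) (⋃ β ∈ Set.Iio α, R β) (Φ α u) u ∧ EqMod (· ≤ ·) (R α) (dl (Φ α u)) x)
    (I : Set W) : EqMod (· ≤ ·) (⋃ β ∈ I, R β) (dl (glue R (stage R Φ) I)) x :=
  dl_glue_eqMod hlow (fun β _ γ _ h => (stage_spec hlow hΦ β).1 γ h)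
    fun β _ => (stage_spec hlow hΦ β).2

/-- Recursion along the filtration: at each stage `exists_extension` prolongs the glued
trivialization, at the price of triviality one degree lower on the union of the earlier pieces. -/
theorem triv_iUnion {R : W → Set BaireMod} (hlow : ∀ α, IsLowerSet (R α)) (hmono : Monotone R)
    (h1 : ∀ α, Triv G (n + 1) (R α)) (h2 : ∀ α, Triv G n (⋃ β ∈ Set.Iio α, R β)) :
    Triv G (n + 1) (⋃ α, R α) := by
  classical
  intro x hx
  have hsub : ∀ α, ⋃ β ∈ Set.Iio α, R β ⊆ R α := fun α =>
    Set.iUnion₂_subset fun β hβ => hmono (le_of_lt hβ)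
  have key : ∀ α (u : Coch G (n + 1)), ∃ y : Coch G (n + 1),
      EqMod (· ≤ ·) (⋃ β ∈ Set.Iio α, R β) (dl u) x →
      EqMod (· ≤ ·) (⋃ β ∈ Set.Iio α, R β) y u ∧ EqMod (· ≤ ·) (R α) (dl y) x := by
    intro α u
    by_cases hu : EqMod (· ≤ ·) (⋃ β ∈ Set.Iio α, R β) (dl u) x
    · obtain ⟨y, hy⟩ := exists_extension (h1 α) (h2 α) (hsub α)
        (hx.mono (Set.subset_iUnion R α)) hu
      exact ⟨y, fun _ => hy⟩
    · exact ⟨0, fun h => absurd h hu⟩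
  choose Φ hΦ using key
  refine ⟨glue R (stage R Φ) Set.univ, ?_⟩
  have := dl_glue_stage hlow hΦ Set.univ
  rw [Set.biUnion_univ] at this
  exact this.symm

end Glue

/-! ### Sets of cardinality at most `ℵ_k` -/

section CardLE

universe v w

/-- The set `S` has at most `ℵ_k` elements. -/
def CardLE (k : ℕ) {X : Type v} (S : Set X) : Prop :=
  Cardinal.mk S ≤ ℵ_ (k : Ordinal.{v})

namespace CardLE

variable {X : Type v} {Y : Type w} {k : ℕ} {S S' : Set X}

theorem lift_aleph_nat (k : ℕ) :
    Cardinal.lift.{w} (ℵ_ (k : Ordinal.{v})) = ℵ_ (k : Ordinal.{max v w}) := by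
  rw [Cardinal.lift_aleph, Ordinal.lift_natCast]

theorem of_countable (h : S.Countable) : CardLE k S :=
  h.le_aleph0.trans (Cardinal.aleph0_le_aleph _)

theorem mono (h : CardLE k S) (hS : S' ⊆ S) : CardLE k S' :=
  (Cardinal.mk_le_mk_of_subset hS).trans h

theorem succ (h : CardLE k S) : CardLE (k + 1) S :=
  h.trans (Cardinal.aleph_le_aleph.2 (by exact_mod_cast k.le_succ))

theorem image (h : CardLE k S) (f : X → Y) : CardLE k (f '' S) := by
  have h1 : Cardinal.lift.{v} (Cardinal.mk (f '' S)) ≤ Cardinal.lift.{w} (Cardinal.mk S) :=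
    Cardinal.mk_image_le_lift
  have h2 := h1.trans (Cardinal.lift_le.2 h)
  rw [lift_aleph_nat, ← lift_aleph_nat.{w, v}] at h2
  exact Cardinal.lift_le.1 h2

theorem union (h : CardLE k S) (h' : CardLE k S') : CardLE k (S ∪ S') :=
  (Cardinal.mk_union_le _ _).trans
    (Cardinal.add_le_of_le (Cardinal.aleph0_le_aleph _) h h')

theorem biUnion (h : CardLE k S) {T : X → Set Y} (hT : ∀ i ∈ S, CardLE k (T i)) :
    CardLE k (⋃ i ∈ S, T i) := by
  have h1 := Cardinal.mk_biUnion_le_lift T S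
  have h2 : Cardinal.lift.{w} (Cardinal.mk S) ≤ ℵ_ (k : Ordinal.{max v w}) := by
    rw [← lift_aleph_nat.{v, w}]
    exact Cardinal.lift_le.2 h
  have h3 : (⨆ x : S, Cardinal.lift.{v} (Cardinal.mk (T x.1))) ≤ ℵ_ (k : Ordinal.{max v w}) := by
    refine ciSup_le' fun i => ?_
    rw [← lift_aleph_nat.{w, v}]
    exact Cardinal.lift_le.2 (hT i i.2)
  have h4 := h1.trans (mul_le_mul' h2 h3)
  rw [Cardinal.mul_eq_self (Cardinal.aleph0_le_aleph _), ← lift_aleph_nat.{w, v}] at h4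
  exact Cardinal.lift_le.1 h4

theorem finsets (h : CardLE k S) : CardLE k {s : Finset X | ↑s ⊆ S} := by
  classical
  have hsub : {s : Finset X | ↑s ⊆ S} ⊆
      (fun s : Finset S => s.map (Function.Embedding.subtype _)) '' Set.univ := by
    intro s hs
    exact ⟨s.subtype (· ∈ S), trivial, Finset.subtype_map_of_mem fun x hx => hs hx⟩
  refine CardLE.mono (CardLE.image ?_ _) hsub
  rcases finite_or_infinite S with hf | hf
  · exact of_countable (Set.to_countable _)
  · rw [CardLE, Cardinal.mk_univ, Cardinal.mk_finset_of_infinite]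
    exact h

theorem prod {T : Set Y} (h : CardLE k S) (hT : CardLE k T) : CardLE k (S ×ˢ T) := by
  have : S ×ˢ T = ⋃ i ∈ S, (fun y => (i, y)) '' T := by
    ext ⟨a, b⟩
    simp [eq_comm, and_comm]
  rw [this]
  exact h.biUnion fun i _ => hT.image _

theorem tuples (h : CardLE k S) (n : ℕ) : CardLE k {t : Fin n → X | ∀ i, t i ∈ S} := by
  induction n with
  | zero => exact of_countable (Set.to_countable _)
  | succ n ih =>
    refine ((h.prod ih).image fun p => (Fin.cons p.1 p.2 : Fin (n + 1) → X)).mono ?_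
    intro t ht
    exact ⟨(t 0, Fin.tail t), ⟨ht 0, fun i => ht i.succ⟩, Fin.cons_self_tail t⟩

theorem exists_injOn (h : CardLE k S) {W : Type w} (hW : ℵ_ (k : Ordinal.{w}) ≤ Cardinal.mk W) :
    ∃ e : X → W, Set.InjOn e S := by
  have h1 : Cardinal.lift.{w} (Cardinal.mk S) ≤ Cardinal.lift.{v} (Cardinal.mk W) := by
    refine (Cardinal.lift_le.2 h).trans ?_
    rw [lift_aleph_nat, ← lift_aleph_nat.{w, v}]
    exact Cardinal.lift_le.2 hW
  obtain ⟨e⟩ := Cardinal.lift_mk_le'.1 h1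
  have : Nonempty W := by
    rw [← Cardinal.mk_ne_zero_iff]
    exact ((Cardinal.aleph_pos _).trans_le hW).ne'
  refine ⟨Function.extend Subtype.val e fun _ => Classical.arbitrary W, fun a ha b hb hab => ?_⟩
  rw [Subtype.val_injective.extend_apply e _ ⟨a, ha⟩,
    Subtype.val_injective.extend_apply e _ ⟨b, hb⟩] at hab
  exact congrArg Subtype.val (e.injective hab)

theorem exists_subset_range (h : CardLE k S) {W : Type w}
    (hW : ℵ_ (k : Ordinal.{w}) ≤ Cardinal.mk W) (x₀ : X) :
    ∃ a : W → X, S ⊆ Set.range a ∧ Set.range a ⊆ insert x₀ S := by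
  classical
  obtain ⟨e, he⟩ := h.exists_injOn hW
  refine ⟨fun w => if h : ∃ x ∈ S, e x = w then h.choose else x₀, fun x hx => ⟨e x, ?_⟩, ?_⟩
  · have hex : ∃ y ∈ S, e y = e x := ⟨x, hx, rfl⟩
    dsimp only
    rw [dif_pos hex]
    exact he hex.choose_spec.1 hx hex.choose_spec.2
  · rintro _ ⟨w, rfl⟩
    dsimp only
    split_ifs with h
    · exact Or.inr h.choose_spec.1
    · exact Or.inl rfl

end CardLE

end CardLE

/-! ### The well-order `ω_{m+1}` -/

section Wo

/-- The ordinals below `ω_{m+1}`. -/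
abbrev Wo (m : ℕ) : Type 1 := Set.Iio (ω_ ((m : Ordinal.{0}) + 1))

variable {m : ℕ}

theorem Wo.mk_eq (m : ℕ) : Cardinal.mk (Wo m) = ℵ_ ((m + 1 : ℕ) : Ordinal.{1}) := by
  rw [Cardinal.mk_Iio_ordinal, Ordinal.card_omega, ← CardLE.lift_aleph_nat.{0, 1}, Nat.cast_succ]

theorem Wo.cardLE_univ (m : ℕ) : CardLE (m + 1) (Set.univ : Set (Wo m)) := by
  rw [CardLE, Cardinal.mk_univ, Wo.mk_eq]

theorem Wo.cardLE_Iio (α : Wo m) : CardLE m (Set.Iio α) := by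
  have h1 : CardLE m (Set.Iio α.1) := by
    rw [CardLE, Cardinal.mk_Iio_ordinal, ← CardLE.lift_aleph_nat.{0, 1}]
    refine Cardinal.lift_le.2 ?_
    have h2 : α.1 < (ℵ_ ((m : Ordinal.{0}) + 1)).ord := by
      rw [Cardinal.ord_aleph]
      exact α.2
    have h3 : ℵ_ ((m : Ordinal.{0}) + 1) = Order.succ (ℵ_ (m : Ordinal.{0})) := by
      rw [Cardinal.succ_aleph]
    exact Order.lt_succ_iff.1 ((Cardinal.lt_ord.1 h2).trans_eq h3)
  refine Cardinal.mk_le_of_injective (f := fun x : Set.Iio α => (⟨x.1.1, x.2⟩ : Set.Iio α.1)) ?_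
    |>.trans h1
  intro x y hxy
  have h2 : x.1.1 = y.1.1 := Subtype.mk.inj hxy
  exact Subtype.ext (Subtype.ext h2)

/-- Regularity of `ω_{m+1}`. -/
theorem Wo.exists_gt {X : Type*} {S : Set X} (hS : CardLE m S) (f : X → Wo m) :
    ∃ b, ∀ x ∈ S, f x < b := by
  by_contra! hc
  have h1 : IsCofinal (f '' S) := fun b => by
    obtain ⟨x, hx, hb⟩ := hc b
    exact ⟨f x, ⟨x, hx, rfl⟩, hb⟩
  have h2 := (Order.cof_le h1).trans (hS.image f)
  rw [Ordinal.cof_Iio, ← Ordinal.lift_cof, Cardinal.cof_omega_add_one, ← Nat.cast_succ,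
    CardLE.lift_aleph_nat.{0, 1}, Cardinal.aleph_le_aleph] at h2
  exact absurd h2 (by exact_mod_cast (Nat.lt_succ_self m).not_ge)

instance (m : ℕ) : Nonempty (Wo m) := ⟨⟨0, Ordinal.omega_pos _⟩⟩

theorem Wo.cardLE_Iic (α : Wo m) : CardLE m (Set.Iic α) := by
  rw [← Set.Iio_insert, ← Set.singleton_union]
  exact (CardLE.of_countable (Set.countable_singleton α)).union (Wo.cardLE_Iio α)

instance (m : ℕ) : NoMaxOrder (Wo m) where
  exists_gt a := by
    obtain ⟨b, hb⟩ := Wo.exists_gt (m := m) (CardLE.of_countable (Set.countable_singleton a)) id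
    exact ⟨b, hb a rfl⟩

theorem Wo.nonempty_Iio {α : Wo m} (hα : α ∈ cofSet m) : (Set.Iio α).Nonempty := by
  by_contra hc
  have h2 : α.1.cof = 0 := by
    rw [Ordinal.cof_eq_zero]
    by_contra h4
    exact hc ⟨⟨0, Ordinal.omega_pos _⟩, bot_lt_iff_ne_bot.2 h4⟩
  have h3 : α.1.cof = ℵ_ (m : Ordinal.{0}) := hα
  rw [h2] at h3
  exact (Cardinal.aleph_pos _).ne h3

/-- A strictly increasing cofinal sequence of length `ω_{m+1}` in an ordinal of that cofinality. -/
theorem Wo.exists_cofinal {α : Wo (m + 1)} (hα : α ∈ cofSet (m + 1)) :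
    ∃ e : Wo m → Wo (m + 1), StrictMono e ∧ (∀ ξ, e ξ < α) ∧ ∀ β < α, ∃ ξ, β ≤ e ξ := by
  obtain ⟨s, hs, hs'⟩ := Ordinal.exists_ord_cof_eq α.1.ToType
  have hα' : α.1.cof.ord = typeLT (ω_ ((m : Ordinal.{0}) + 1)).ToType := by
    have h : α.1.cof = ℵ_ ((m + 1 : ℕ) : Ordinal.{0}) := hα
    rw [h, Cardinal.ord_aleph, Ordinal.type_toType, Nat.cast_succ]
  rw [Ordinal.cof_toType, hα'] at hs'
  obtain ⟨i⟩ := Ordinal.type_eq.1 hs'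
  let j : s ≃o (ω_ ((m : Ordinal.{0}) + 1)).ToType := OrderIso.ofRelIsoLT i
  have hlt : ∀ x : α.1.ToType, (Ordinal.ToType.mk.symm x).1 < α.1 := fun x =>
    (Ordinal.ToType.mk.symm x).2
  refine ⟨fun ξ => ⟨(Ordinal.ToType.mk.symm (j.symm (Ordinal.ToType.mk ξ)).1).1,
    (hlt _).trans α.2⟩, fun ξ η h => ?_, fun ξ => hlt _, fun β hβ => ?_⟩
  · have h1 : j.symm (Ordinal.ToType.mk ξ) < j.symm (Ordinal.ToType.mk η) :=
      j.symm.strictMono (Ordinal.ToType.mk.strictMono h)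
    exact Ordinal.ToType.mk.symm.strictMono h1
  · obtain ⟨b, hb, hb'⟩ := hs (Ordinal.ToType.mk ⟨β.1, hβ⟩)
    refine ⟨Ordinal.ToType.mk.symm (j ⟨b, hb⟩), ?_⟩
    have h2 := Ordinal.ToType.mk.symm.monotone hb'
    rw [OrderIso.symm_apply_apply] at h2
    have h3 : β.1 ≤ (Ordinal.ToType.mk.symm b).1 := h2
    change β.1 ≤ _
    simpa using h3

end Wo

/-! ### Ideals of `(ω^ω, ≤*)` and the triviality of families on small ideals -/

section Ideal

/-- The pointwise maximum of finitely many functions. -/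
def joinF (s : Finset BaireMod) : BaireMod := fun i => s.sup fun f : BaireMod => f i

theorem le_joinF {s : Finset BaireMod} {f : BaireMod} (h : f ∈ s) : f ≤ joinF s := by
  have : {i : ℕ | ¬ f i ≤ joinF s i} = ∅ := by
    ext i
    simp only [Set.mem_ofPred_eq, Set.mem_empty_iff_false, iff_false, not_not]
    exact Finset.le_sup (f := fun f : BaireMod => f i) h
  change Set.Finite {i : ℕ | ¬ f i ≤ joinF s i}
  rw [this]
  exact Set.finite_empty

theorem joinF_le {s : Finset BaireMod} {g : BaireMod} (h : ∀ f ∈ s, f ≤ g) : joinF s ≤ g := by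
  have h' : (⋃ f ∈ s, {i : ℕ | ¬ f i ≤ g i}).Finite :=
    s.finite_toSet.biUnion fun f hf => h f hf
  refine h'.subset fun i hi => ?_
  by_contra hc
  simp only [Set.mem_iUnion, Set.mem_ofPred_eq, not_exists, not_not] at hc
  exact hi (Finset.sup_le hc)

/-- The ideal of `(ω^ω, ≤*)` generated by `A`. -/
def ideal (A : Set BaireMod) : Set BaireMod :=
  {p | ∃ s : Finset BaireMod, ↑s ⊆ A ∧ p ≤ joinF s}

variable {A A' : Set BaireMod}

theorem isLowerSet_ideal (A : Set BaireMod) : IsLowerSet (ideal A) := by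
  rintro p q hqp ⟨s, hs, hp⟩
  exact ⟨s, hs, hqp.trans hp⟩

theorem joinF_mem_ideal {s : Finset BaireMod} (h : ↑s ⊆ A) : joinF s ∈ ideal A := ⟨s, h, le_rfl⟩

theorem subset_ideal (A : Set BaireMod) : A ⊆ ideal A := fun p hp =>
  ⟨{p}, by simpa using hp, le_joinF (by simp)⟩

theorem ideal_mono (h : A ⊆ A') : ideal A ⊆ ideal A' := by
  rintro p ⟨s, hs, hp⟩
  exact ⟨s, hs.trans h, hp⟩

theorem ideal_subset_ideal (h : A ⊆ ideal A') : ideal A ⊆ ideal A' := by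
  classical
  rintro p ⟨s, hs, hp⟩
  choose! F hF hF' using h
  refine ⟨s.biUnion F, ?_, hp.trans (joinF_le fun f hf => (hF' (hs hf)).trans ?_)⟩
  · intro q hq
    obtain ⟨f, hf, hq⟩ := Finset.mem_biUnion.1 hq
    exact hF (hs hf) hq
  · exact joinF_le fun q hq => le_joinF (Finset.mem_biUnion.2 ⟨f, hf, hq⟩)

theorem exists_range_ideal_eq {k : ℕ} (h : CardLE k A) {W : Type*}
    (hW : ℵ_ (k : Ordinal) ≤ Cardinal.mk W) :
    ∃ a : W → BaireMod, A ⊆ Set.range a ∧ ideal (Set.range a) = ideal A := by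
  obtain ⟨a, h1, h2⟩ := h.exists_subset_range hW (joinF ∅)
  refine ⟨a, h1, (ideal_subset_ideal (h2.trans ?_)).antisymm (ideal_mono h1)⟩
  exact Set.insert_subset (joinF_mem_ideal (by simp)) (subset_ideal A)

/-- A member of the right-hand ideal uses only finitely many generators, and by monotonicity these
already lie in one `D β`. -/
theorem biUnion_ideal {W : Type*} [LinearOrder W] {D : W → Set BaireMod} (hD : Monotone D)
    {I : Set W} (hI : I.Nonempty) : ⋃ β ∈ I, ideal (D β) = ideal (⋃ β ∈ I, D β) := by
  refine (Set.iUnion₂_subset fun β hβ => ideal_mono (Set.subset_biUnion_of_mem hβ)).antisymm ?_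
  rintro p ⟨s, hs, hp⟩
  have h1 : ∃ β ∈ I, ↑s ⊆ D β := by
    clear hp
    induction s using Finset.cons_induction with
    | empty => exact ⟨hI.some, hI.some_mem, by simp⟩
    | cons f s hf ih =>
      rw [Finset.coe_cons, Set.insert_subset_iff] at hs
      obtain ⟨β, hβ, h1⟩ := ih hs.2
      obtain ⟨γ, hγ, h2⟩ := Set.mem_iUnion₂.1 hs.1
      rw [Finset.coe_cons]
      rcases le_total β γ with h | h
      · exact ⟨γ, hγ, Set.insert_subset h2 (h1.trans (hD h))⟩
      · exact ⟨β, hβ, Set.insert_subset (hD h h2) h1⟩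
  obtain ⟨β, hβ, h1⟩ := h1
  exact Set.mem_iUnion₂.2 ⟨β, hβ, s, h1, hp⟩

end Ideal

/-! ### Triviality of coherent families on ideals with few generators -/

section Triv

variable {G : Type*} [AddCommGroup G] {n k : ℕ} {A : Set BaireMod}

theorem triv_ideal_of_finite (hA : A.Finite) : Triv G n (ideal A) := by
  refine triv_of_isGreatest (d := joinF hA.toFinset) (joinF_mem_ideal (by simp)) ?_
  rintro p ⟨s, hs, hp⟩
  exact hp.trans (joinF_le fun f hf => le_joinF (hA.mem_toFinset.2 (hs hf)))

theorem triv_ideal_range {W : Type*} [LinearOrder W] [WellFoundedLT W] [Nonempty W]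
    (a : W → BaireMod) (h1 : ∀ α, Triv G (n + 1) (ideal (a '' Set.Iic α)))
    (h2 : ∀ α, Triv G n (ideal (a '' Set.Iio α))) : Triv G (n + 1) (ideal (Set.range a)) := by
  have hmono : Monotone fun α => a '' Set.Iic α := fun α β h =>
    Set.image_mono (Set.Iic_subset_Iic.2 h)
  have e : ⋃ α, ideal (a '' Set.Iic α) = ideal (Set.range a) := by
    have := biUnion_ideal hmono (Set.univ_nonempty (α := W))
    rw [Set.biUnion_univ, Set.biUnion_univ] at this
    rw [this]
    congr 1
    ext p
    simp only [Set.mem_iUnion, Set.mem_image, Set.mem_Iic, Set.mem_range]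
    exact ⟨fun ⟨_, x, _, h⟩ => ⟨x, h⟩, fun ⟨x, h⟩ => ⟨x, x, le_rfl, h⟩⟩
  rw [← e]
  refine triv_iUnion (fun α => isLowerSet_ideal _) (fun α β h => ideal_mono (hmono h)) h1 fun α => ?_
  rcases (Set.Iio α).eq_empty_or_nonempty with h | h
  · rw [h, Set.biUnion_empty]
    exact triv_empty
  · rw [biUnion_ideal hmono h]
    convert h2 α using 2
    ext p
    simp only [Set.mem_iUnion, Set.mem_image, Set.mem_Iic, Set.mem_Iio]
    exact ⟨fun ⟨β, hβ, x, hx, h⟩ => ⟨x, hx.trans_lt hβ, h⟩, fun ⟨x, hx, h⟩ => ⟨x, hx, x, le_rfl, h⟩⟩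

/-- Finite joins of the generators give an increasing sequence `d k` cofinal in the ideal, and
countably many functions that cohere along it can be uniformized. -/
theorem triv_zero_of_countable (hA : A.Countable) : Triv G 0 (ideal A) := by
  classical
  intro x hx
  obtain ⟨a, -, ha⟩ := exists_range_ideal_eq (k := 0) (CardLE.of_countable hA) (W := ℕ) (by simp)
  rw [← ha] at hx ⊢
  let d : ℕ → BaireMod := fun k => joinF ((Finset.range (k + 1)).image a)
  have hdmem : ∀ k, d k ∈ ideal (Set.range a) := fun k => joinF_mem_ideal (by simp)
  have hdmono : ∀ j k, j ≤ k → d j ≤ d k := fun j k hjk => joinF_le fun f hf => le_joinF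
    (Finset.image_subset_image (Finset.range_mono (Nat.succ_le_succ hjk)) hf)
  have hdcof : ∀ p ∈ ideal (Set.range a), ∃ k, p ≤ d k := by
    intro p hp
    have e : Set.range a = ⋃ k ∈ Set.univ, a '' Set.Iic k := by
      ext p
      simp only [Set.mem_iUnion, Set.mem_image, Set.mem_Iic, Set.mem_range, Set.mem_univ]
      exact ⟨fun ⟨x, h⟩ => ⟨x, trivial, x, le_rfl, h⟩, fun ⟨_, _, x, _, h⟩ => ⟨x, h⟩⟩
    rw [e, ← biUnion_ideal (fun α β h => Set.image_mono (Set.Iic_subset_Iic.2 h))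
      Set.univ_nonempty] at hp
    obtain ⟨k, -, s, hs, hp⟩ := Set.mem_iUnion₂.1 hp
    refine ⟨k, hp.trans (joinF_le fun f hf => le_joinF ?_)⟩
    obtain ⟨j, hj, rfl⟩ := hs hf
    exact Finset.mem_image_of_mem _ (Finset.mem_range.2 (Nat.lt_succ_of_le hj))
  have hcoh : ∀ p q, p ≤ q → q ∈ ideal (Set.range a) →
      x (fun _ => p) - x (fun _ => q) ∈ null G p := by
    intro p q hpq hq
    have h1 := hx ![p, q] ⟨fun i => ?_, fun i j hij => ?_⟩
    · have e1 : (![p, q] : Fin 2 → BaireMod) ∘ Fin.succAbove 0 = fun _ => q := by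
        funext i
        fin_cases i
        rfl
      have e2 : (![p, q] : Fin 2 → BaireMod) ∘ Fin.succAbove 1 = fun _ => p := by
        funext i
        fin_cases i
        rfl
      rw [dl_apply, Fin.sum_univ_two, e1, e2] at h1
      have h2 := neg_mem h1
      convert h2 using 1
      · simp
      · simp [sub_eq_add_neg]
    · fin_cases i
      · exact isLowerSet_ideal _ hpq hq
      · exact hq
    · fin_cases i <;> fin_cases j
      · exact le_rfl
      · exact hpq
      · exact absurd hij (by decide)
      · exact le_rfl
  -- At each point `ψ` follows the first `d k` whose graph lies above it. Below `d k` only the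
  -- values at `d 0, …, d k` are used, and each of them differs from the value at `d k` at finitely
  -- many of the relevant points.
  let ψ : ℕ × ℕ → G := fun p =>
    if h : ∃ k, p.2 < d k p.1 then x (fun _ => d (Nat.find h)) p else 0
  refine ⟨fun _ => ψ, fun t ht => ?_⟩
  have e : dl (fun _ : Fin 0 → BaireMod => ψ) t = ψ := by
    rw [dl_apply]
    simp
  have et : t = fun _ => t 0 := by
    funext i
    rw [Fin.fin_one_eq_zero i]
  rw [e]
  obtain ⟨k, hk⟩ := hdcof _ (ht.1 0)
  have h1 : x (fun _ => d k) - ψ ∈ null G (d k) := by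
    have hfin : (⋃ j ∈ Set.Iic k, {p : ℕ × ℕ | p.2 < d j p.1 ∧
        (x (fun _ => d j) - x (fun _ => d k)) p ≠ 0}).Finite :=
      (Set.finite_Iic k).biUnion fun j hj => hcoh _ _ (hdmono j k hj) (hdmem k)
    refine hfin.subset ?_
    rintro p ⟨hp1, hp2⟩
    have hex : ∃ k, p.2 < d k p.1 := ⟨k, hp1⟩
    refine Set.mem_iUnion₂.2 ⟨Nat.find hex, Nat.find_min' hex hp1, Nat.find_spec hex, fun h => hp2 ?_⟩
    have hψ : ψ p = x (fun _ => d (Nat.find hex)) p := dif_pos hex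
    rw [Pi.sub_apply, sub_eq_zero] at h ⊢
    rw [hψ, h]
  have h2 := add_mem (hcoh _ _ hk (hdmem k)) (null_anti hk h1)
  rw [sub_add_sub_cancel, ← et] at h2
  exact h2

/-- Coherent `(n + 1)`-families are trivial on ideals with at most `ℵ_k` generators, if `k ≤ n`. -/
theorem triv_ideal (hkn : k ≤ n) (hA : CardLE k A) : Triv G n (ideal A) := by
  induction k generalizing n A with
  | zero =>
    have hA' : A.Countable := by
      have : Cardinal.mk A ≤ ℵ_ ((0 : ℕ) : Ordinal.{0}) := hA
      rwa [Nat.cast_zero, Cardinal.aleph_zero, Cardinal.le_aleph0_iff_set_countable] at this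
    obtain _ | n := n
    · exact triv_zero_of_countable hA'
    · obtain ⟨a, -, ha⟩ := exists_range_ideal_eq hA (W := ℕ) (by simp)
      rw [← ha]
      exact triv_ideal_range a (fun α => triv_ideal_of_finite ((Set.finite_Iic α).image a))
        fun α => triv_ideal_of_finite ((Set.finite_Iio α).image a)
  | succ k ih =>
    obtain _ | n := n
    · omega
    -- With the generators listed in type `ω_{k+1}`, initial segments have at most `ℵ_k` members.
    -- The induction hypothesis therefore serves in both degrees, `n + 1` and `n`, as `k ≤ n`.
    · obtain ⟨a, -, ha⟩ := exists_range_ideal_eq hA (W := Wo k) (Wo.mk_eq k).ge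
      rw [← ha]
      refine triv_ideal_range a (fun α => ih (by omega) ?_) fun α => ih (by omega) ?_
      · exact (Wo.cardLE_Iic α).image a
      · exact (Wo.cardLE_Iio α).image a

end Triv

/-! ### Weak diamonds and the coding of sets -/

section Diamond

variable {m : ℕ}

/-- Unboundedness: iterate, from `γ`, a step that exceeds all values of `h` up to the current point;
the supremum of the `ω` iterates exists because `ω_{m+1}` has uncountable cofinality. -/
theorem Wo.isClub_closurePoints (h : Wo m → Wo m) : IsClub {α : Wo m | ∀ β < α, h β < α} := by
  refine ⟨fun d hd hne _ a ha β hβ => ?_, fun γ => ?_⟩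
  · obtain ⟨x, hx, hβx⟩ := (lt_isLUB_iff ha).1 hβ
    exact (hd hx β hβx).trans_le (ha.1 hx)
  · have hstep : ∀ γ : Wo m, ∃ b, γ < b ∧ ∀ β ≤ γ, h β < b := by
      intro γ
      obtain ⟨b, hb⟩ := Wo.exists_gt (Wo.cardLE_Iic γ) h
      obtain ⟨b', hb'⟩ := NoMaxOrder.exists_gt (max b γ)
      exact ⟨b', (le_max_right _ _).trans_lt hb',
        fun β hβ => (hb β hβ).trans ((le_max_left _ _).trans_lt hb')⟩
    choose s hs hs' using hstep
    let c : ℕ → Wo m := fun n => s^[n] γ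
    have hc : ∀ n, c (n + 1) = s (c n) := fun n => Function.iterate_succ_apply' s n γ
    obtain ⟨b, hb⟩ := Wo.exists_gt (m := m) (CardLE.of_countable (Set.countable_univ (α := ℕ))) c
    have hne : {x : Wo m | ∀ n, c n ≤ x}.Nonempty := ⟨b, fun n => (hb n trivial).le⟩
    refine ⟨wellFounded_lt.min _ hne, fun β hβ => ?_, wellFounded_lt.min_mem _ hne 0⟩
    have h1 := fun hmem => wellFounded_lt.not_lt_min {x : Wo m | ∀ n, c n ≤ x} hmem hβ
    simp only [Set.mem_ofPred_eq, imp_false, not_forall, not_le] at h1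
    obtain ⟨n, hn⟩ := h1
    refine (hs' (c n) β hn.le).trans_le ?_
    rw [← hc]
    exact wellFounded_lt.min_mem _ hne (n + 1)

/-- The weak diamond predicts subsets `b` of any set filtered by small pieces `V β`, at points `α`
that are closed under a given function `h`. -/
theorem WeakDiamond.exists_guess (hw : WeakDiamond (cofSet m)) {B : Type*} {V : Wo m → Set B}
    (hV : ∀ β, CardLE m (V β)) (h : Wo m → Wo m) (F : Wo m → Set B → Prop) :
    ∃ g : Set (Wo m), ∀ b : Set B, ∃ α ∈ cofSet m, (∀ β < α, h β < α) ∧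
      (α ∈ g ↔ F α (b ∩ ⋃ β ∈ Set.Iio α, V β)) := by
  classical
  have hU : CardLE (m + 1) (⋃ β ∈ Set.univ, V β) :=
    (Wo.cardLE_univ m).biUnion fun β _ => (hV β).succ
  obtain ⟨e, he⟩ := hU.exists_injOn (Wo.mk_eq m).ge
  have hmem : ∀ {β x}, x ∈ V β → x ∈ ⋃ β ∈ Set.univ, V β := fun hx =>
    Set.mem_biUnion (Set.mem_univ _) hx
  -- A subset of `B` is coded by its image under the injection `e` into `Wo m`. Since `k β` bounds
  -- `e` on `V β`, at points closed under `k` the code below `α` determines the part of the set in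
  -- the `V β` with `β < α`.
  choose k hk using fun β => Wo.exists_gt (hV β) e
  obtain ⟨g, hg⟩ := hw fun α s => decide
    (F α {x | x ∈ ⋃ β ∈ Set.Iio α, V β ∧ ∃ hx : e x < α, s ⟨e x, hx⟩ = true})
  refine ⟨{α | g α = true}, fun b => ?_⟩
  obtain ⟨α, ⟨hα, hgα⟩, hcl⟩ := hg (fun w => decide (∃ x ∈ b, x ∈ ⋃ β ∈ Set.univ, V β ∧ e x = w))
    (Wo.isClub_closurePoints fun β => max (h β) (k β))
  refine ⟨α, hα, fun β hβ => (le_max_left _ _).trans_lt (hcl β hβ), ?_⟩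
  have e1 : {x | x ∈ ⋃ β ∈ Set.Iio α, V β ∧ ∃ _ : e x < α,
      decide (∃ y ∈ b, y ∈ ⋃ β ∈ Set.univ, V β ∧ e y = e x) = true} =
      b ∩ ⋃ β ∈ Set.Iio α, V β := by
    ext x
    constructor
    · rintro ⟨hx, _, hy⟩
      obtain ⟨y, hyb, hyU, hyx⟩ := of_decide_eq_true hy
      obtain ⟨β, _, hxβ⟩ := Set.mem_iUnion₂.1 hx
      exact ⟨he hyU (hmem hxβ) hyx ▸ hyb, hx⟩
    · rintro ⟨hxb, hx⟩
      obtain ⟨β, hβ, hxβ⟩ := Set.mem_iUnion₂.1 hx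
      exact ⟨hx, (hk β x hxβ).trans ((le_max_right _ _).trans_lt (hcl β hβ)),
        decide_eq_true ⟨x, hxb, hmem hxβ, rfl⟩⟩
  rw [← e1]
  change g α = true ↔ _
  rw [hgα, decide_eq_true_iff]

end Diamond

/-! ### Twisting cochains -/

section Cone

variable {G : Type*} [AddCommGroup G] {m : ℕ}

open Classical in
/-- The cochain `(t, u) ↦ w t` on the tuples with exactly the last entry outside `P`. -/
noncomputable def cone (P : Set BaireMod) (w : Coch G m) : Coch G (m + 1) := fun t =>
  if (∀ i : Fin m, t i.castSucc ∈ P) ∧ t (Fin.last m) ∉ P then w (Fin.init t) else 0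

theorem cone_snoc {P : Set BaireMod} (w : Coch G m) {t : Fin m → BaireMod} (ht : ∀ i, t i ∈ P)
    {u : BaireMod} (hu : u ∉ P) : cone P w (Fin.snoc t u) = w t := by
  rw [cone, if_pos ⟨fun i => by simpa using ht i, by simpa using hu⟩, Fin.init_snoc]

theorem cone_of_last_mem {P : Set BaireMod} (w : Coch G m) {t : Fin (m + 1) → BaireMod}
    (h : t (Fin.last m) ∈ P) : cone P w t = 0 :=
  if_neg fun hc => hc.2 h

/-- The cases depend on which of the last two entries of `t` lie in `P`. If the last entry does,
every term vanishes; if only the last entry is outside, the coboundary reduces to that of `w`. -/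
theorem dl_cone {P : Set BaireMod} (hP : IsLowerSet P) {w : Coch G m}
    (hw : EqMod (· ≤ ·) P (dl w) 0) : EqMod (· ≤ ·) Set.univ (dl (cone P w)) 0 := by
  intro t ht
  rw [Pi.zero_apply, sub_zero]
  by_cases hb : t (Fin.last (m + 1)) ∈ P
  · have h0 : dl (cone P w) t = 0 := by
      rw [dl_apply]
      refine Finset.sum_eq_zero fun i _ => ?_
      rw [cone_of_last_mem, smul_zero]
      exact hP (ht.2 _ _ (Fin.le_last _)) hb
    rw [h0]
    exact zero_mem _
  by_cases ha : t (Fin.last m).castSucc ∈ P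
  · have hs : ∀ i : Fin (m + 1), Fin.init t i ∈ P := fun i =>
      hP (ht.2 i.castSucc _ (Fin.castSucc_le_castSucc_iff.2 (Fin.le_last i))) ha
    have e : dl (cone P w) t = dl w (Fin.init t) := by
      conv_lhs => rw [← Fin.snoc_init_self t]
      rw [dl_snoc, cone_of_last_mem (t := Fin.init t) w (hs _), smul_zero, add_zero, dl_apply,
        dl_apply]
      refine Finset.sum_congr rfl fun i _ => ?_
      rw [cone_snoc w (t := Fin.init t ∘ i.succAbove) (fun j => hs _) hb]
    have h1 := hw (Fin.init t) ⟨hs, fun i j hij => ht.2 _ _ (Fin.castSucc_le_castSucc_iff.2 hij)⟩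
    rw [Pi.zero_apply, sub_zero] at h1
    rw [e]
    exact h1
  -- With the last two entries outside `P`, deleting an earlier entry leaves a face with both, where
  -- the cone vanishes; the two remaining faces give equal values with opposite signs.
  · have h0 : dl (cone P w) t = 0 := by
      rw [dl_apply, Fin.sum_univ_castSucc, Fin.sum_univ_castSucc, Finset.sum_eq_zero, zero_add]
      · have e : cone P w (t ∘ (Fin.last m).castSucc.succAbove) =
            cone P w (t ∘ (Fin.last (m + 1)).succAbove) := by
          have e1 : ∀ i : Fin m, (Fin.last m).castSucc.succAbove i.castSucc = i.castSucc.castSucc :=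
            fun i => by
              rw [Fin.castSucc_succAbove_castSucc, Fin.succAbove_last]
          have e2 : (Fin.last m).castSucc.succAbove (Fin.last m) = Fin.last (m + 1) := by
            rw [Fin.succAbove_castSucc_self, Fin.succ_last]
          have e3 : Fin.init (t ∘ (Fin.last m).castSucc.succAbove) =
              Fin.init (t ∘ (Fin.last (m + 1)).succAbove) := by
            funext i
            simp [Fin.init, e1]
          have hiff : ((∀ i : Fin m, (t ∘ (Fin.last m).castSucc.succAbove) i.castSucc ∈ P) ∧
              (t ∘ (Fin.last m).castSucc.succAbove) (Fin.last m) ∉ P) ↔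
              ((∀ i : Fin m, (t ∘ (Fin.last (m + 1)).succAbove) i.castSucc ∈ P) ∧
              (t ∘ (Fin.last (m + 1)).succAbove) (Fin.last m) ∉ P) := by
            simp only [Function.comp_apply, e1, e2, Fin.succAbove_last, hb, ha]
          by_cases hc : (∀ i : Fin m, (t ∘ (Fin.last m).castSucc.succAbove) i.castSucc ∈ P) ∧
              (t ∘ (Fin.last m).castSucc.succAbove) (Fin.last m) ∉ P
          · rw [cone, cone, if_pos hc, if_pos (hiff.1 hc), e3]
          · rw [cone, cone, if_neg hc, if_neg fun h => hc (hiff.2 h)]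
        rw [e, Fin.val_castSucc, Fin.val_last, Fin.val_last, pow_succ, mul_neg_one, neg_smul,
          add_neg_cancel]
      · intro i _
        have hm : 0 < m := i.pos
        rw [cone, if_neg, smul_zero]
        rintro ⟨h1, -⟩
        refine ha ?_
        have h2 := h1 ⟨m - 1, by omega⟩
        have e : i.castSucc.castSucc.succAbove (⟨m - 1, by omega⟩ : Fin m).castSucc =
            (Fin.last m).castSucc := by
          rw [Fin.succAbove_of_le_castSucc]
          · ext
            simp
            omega
          · rw [Fin.le_def]
            simp
            omega
        rwa [Function.comp_apply, e] at h2
    rw [h0]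
    exact zero_mem _

end Cone

/-! ### Nontrivial coherent families -/

section Nonvanish

variable {G K : Type*} [AddCommGroup G] [AddCommGroup K]

/-- The image of a cochain under a homomorphism of the coefficient groups. -/
def Coch.map (φ : G →+ K) {n : ℕ} (x : Coch G n) : Coch K n := fun t => φ.compLeft _ (x t)

theorem Coch.map_dl (φ : G →+ K) {n : ℕ} (x : Coch G n) : Coch.map φ (dl x) = dl (Coch.map φ x) :=
  funext fun t => dl_map (φ.compLeft _) x t

theorem map_mem_null (φ : G →+ K) {f : BaireMod} {h : ℕ × ℕ → G} (hh : h ∈ null G f) :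
    φ.compLeft _ h ∈ null K f := by
  refine (mem_null.1 hh).subset ?_
  rintro p ⟨h1, h2⟩
  exact ⟨h1, fun h0 => h2 (by simp [h0])⟩

theorem EqMod.map (φ : G →+ K) {n : ℕ} {x y : Coch G (n + 1)} {r : BaireMod → BaireMod → Prop}
    {R : Set BaireMod} (h : EqMod r R x y) : EqMod r R (Coch.map φ x) (Coch.map φ y) := by
  intro t ht
  have := map_mem_null φ (h t ht)
  rwa [map_sub] at this

/-- The relation `r` is a preorder finer than `≤*`. -/
structure FinerOrder (r : BaireMod → BaireMod → Prop) : Prop where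
  refl : ∀ f, r f f
  trans : ∀ f g h, r f g → r g h → r f h
  le : ∀ f g, r f g → f ≤ g

/-- A sequence of countable levels `T β` in the ideal generated by `A`, coinitial in one another for
the relation `r`, and jointly unbounded in that ideal. -/
structure IsTest (r : BaireMod → BaireMod → Prop) (A : Set BaireMod) {W : Type*} [LinearOrder W]
    (T : W → Set BaireMod) : Prop where
  countable : ∀ β, (T β).Countable
  nonempty : ∀ β, (T β).Nonempty
  subset : ∀ β, T β ⊆ ideal A
  exists_rel : ∀ β α, β < α → ∀ u ∈ T α, ∃ t ∈ T β, r t u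
  unbounded : ∀ p ∈ ideal A, ∃ β, ∀ t ∈ T β, ¬ t ≤ p

/-- On every ideal with `ℵ_{m+1}` generators there is a coherent `(m + 1)`-family whose image under
`φ` is not trivial on the `r`-increasing tuples of a given test sequence. -/
def Nonvanishing (r : BaireMod → BaireMod → Prop) (φ : G →+ K) (m : ℕ) : Prop :=
  ∀ (A : Set BaireMod) (T : Wo m → Set BaireMod), CardLE (m + 1) A → IsTest r A T →
    ∃ x : Coch G (m + 1), EqMod (· ≤ ·) (ideal A) (dl x) 0 ∧
      ¬ ∃ y : Coch K m, EqMod r (⋃ β, T β) (Coch.map φ x) (dl y)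

/-- There is a twist of the `(m + 1)`-families at `u` over the ideal `P` that cannot be absorbed by
an `m`-family that vanishes on the tuples of `S`. -/
def HasTwist (r : BaireMod → BaireMod → Prop) (φ : G →+ K) (m : ℕ) (P S : Set BaireMod)
    (u : BaireMod) : Prop :=
  ∃ w : Coch G m, EqMod (· ≤ ·) P (dl w) 0 ∧
    ¬ ∃ v : Coch K m, (∀ s, Tup r S s → v s = 0) ∧
      EqMod r (insert u S) (Coch.map φ (cone P w)) (dl v)

/-- Diagonalization: for the increasing joins `d k` of the generators, choose increasing `i k` with
`d k (i k) < u (i k)` and let `E` consist of the points `(i k, d k (i k))`. All of them lie below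
`u`, but if `p ≤* d l` then almost all of them lie on or above the graph of `p`. -/
theorem exists_null_of_countable {A : Set BaireMod} (hA : A.Countable) {u : BaireMod}
    (hu : u ∉ ideal A) (c : G) :
    ∃ E : Set (ℕ × ℕ), {p ∈ E | p.2 < u p.1}.Infinite ∧
      ∀ p ∈ ideal A, E.indicator (fun _ => c) ∈ null G p := by
  classical
  obtain ⟨a, hsub, ha⟩ := exists_range_ideal_eq (k := 0) (CardLE.of_countable hA) (W := ℕ) (by simp)
  rw [← ha] at hu ⊢
  let d : ℕ → BaireMod := fun k => joinF ((Finset.range (k + 1)).image a)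
  have hd : ∀ k, ∃ᶠ i in Filter.atTop, d k i < u i := by
    intro k
    rw [Nat.frequently_atTop_iff_infinite]
    intro hfin
    refine hu (isLowerSet_ideal _ ?_ (joinF_mem_ideal (s := (Finset.range (k + 1)).image a) (by simp)))
    change Set.Finite {i : ℕ | ¬ u i ≤ d k i}
    simpa only [not_le] using hfin
  obtain ⟨i, hi, hdi⟩ := Filter.extraction_forall_of_frequently hd
  refine ⟨Set.range fun k => (i k, d k (i k)), ?_, ?_⟩
  · refine (Set.infinite_range_of_injective (f := fun k => (i k, d k (i k))) fun k l h =>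
      hi.injective (congrArg Prod.fst h)).mono ?_
    rintro _ ⟨k, rfl⟩
    exact ⟨⟨k, rfl⟩, hdi k⟩
  · rintro p ⟨s, hs, hp⟩
    have hl : ∃ l, ∀ f ∈ s, f ∈ (Finset.range (l + 1)).image a := by
      have hs' : ∀ f ∈ s, ∃ j, a j = f := fun f hf => hs hf
      choose! j hj using hs'
      refine ⟨s.sup j, fun f hf => Finset.mem_image.2 ⟨j f, ?_, hj f hf⟩⟩
      exact Finset.mem_range.2 (Nat.lt_succ_of_le (Finset.le_sup hf))
    obtain ⟨l, hl⟩ := hl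
    have hpl : {i : ℕ | ¬ p i ≤ d l i}.Finite := hp.trans (joinF_le fun f hf => le_joinF (hl f hf))
    have hfin : {k | k < l ∨ ¬ p (i k) ≤ d l (i k)}.Finite :=
      (Set.finite_lt_nat l).union (hpl.preimage hi.injective.injOn)
    refine (hfin.image fun k => (i k, d k (i k))).subset ?_
    rintro q ⟨hq1, hq2⟩
    obtain ⟨k, rfl⟩ := Set.mem_of_indicator_ne_zero hq2
    refine ⟨k, ?_, rfl⟩
    by_contra hc
    simp only [Set.mem_ofPred_eq, not_or, not_lt, not_not] at hc
    have h1 : d l (i k) ≤ d k (i k) := by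
      refine Finset.sup_mono (Finset.image_subset_image (Finset.range_mono ?_))
      exact Nat.succ_le_succ hc.1
    exact absurd (hc.2.trans h1) (not_le.2 hq1)

/-- The empty tuple is a tuple of any `S`, so the absorbing `0`-cochain `v` vanishes; it remains to
choose `w` null on the ideal with `φ ∘ w` not null below `u`. -/
theorem hasTwist_zero {r : BaireMod → BaireMod → Prop} (hr : FinerOrder r) {φ : G →+ K}
    (hφ : φ ≠ 0) {A : Set BaireMod} (hA : A.Countable) {S : Set BaireMod} {u : BaireMod}
    (hu : u ∉ ideal A) : HasTwist r φ 0 (ideal A) S u := by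
  obtain ⟨c, hc⟩ : ∃ c, φ c ≠ 0 := by
    by_contra! h
    exact hφ (AddMonoidHom.ext h)
  obtain ⟨E, hE, hnull⟩ := exists_null_of_countable hA hu c
  refine ⟨fun _ => E.indicator fun _ => c, fun t ht => ?_, ?_⟩
  · rw [Pi.zero_apply, sub_zero, dl_apply]
    simpa using hnull _ (ht.1 0)
  · rintro ⟨v, hv, h⟩
    have h1 := h (fun _ => u) ⟨fun _ => Set.mem_insert _ _, fun _ _ _ => hr.refl u⟩
    have e1 : dl v (fun _ => u) = 0 := by
      rw [dl_apply, Finset.sum_eq_zero]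
      intro i _
      rw [hv _ ⟨fun j => j.elim0, fun j => j.elim0⟩, smul_zero]
    rw [e1, sub_zero, Coch.map, cone, if_pos ⟨fun j => j.elim0, hu⟩] at h1
    refine hE ((mem_null.1 h1).subset ?_)
    rintro p ⟨hp1, hp2⟩
    refine ⟨hp2, ?_⟩
    simpa [Set.indicator_of_mem hp1] using hc

/-- If `δv` equals the image of the cone and `v` vanishes on `S`, then evaluation at `(t, u)` leaves
`δ(v(·, u)) t = φ (w t)` modulo finite, which trivializes the image of `w` on the test sequence. -/
theorem hasTwist_succ {r : BaireMod → BaireMod → Prop} (hr : FinerOrder r) {φ : G →+ K} {m : ℕ}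
    (hN : Nonvanishing r φ m) {A : Set BaireMod} (hA : CardLE (m + 1) A) {T : Wo m → Set BaireMod}
    (hT : IsTest r A T) {S : Set BaireMod} (hS : S ⊆ ideal A) {u : BaireMod}
    (hTS : ∀ ξ, T ξ ⊆ S) (hTu : ∀ ξ, ∀ t ∈ T ξ, r t u) (hu : u ∉ ideal A) :
    HasTwist r φ (m + 1) (ideal A) S u := by
  obtain ⟨w, hw, hw'⟩ := hN A T hA hT
  refine ⟨w, hw, fun ⟨v, hv, h⟩ => hw' ⟨fun s => v (Fin.snoc s u), fun t ht => ?_⟩⟩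
  have htS : Tup r S t := ht.mono (Set.iUnion_subset hTS)
  have h1 := h (Fin.snoc t u) ((htS.mono (Set.subset_insert u S)).snoc (Set.mem_insert _ _)
    (hr.refl u) fun i => by
      obtain ⟨ξ, hξ⟩ := Set.mem_iUnion.1 (ht.1 i)
      exact hTu ξ _ hξ)
  have e0 : (Fin.snoc t u : Fin (m + 2) → BaireMod) 0 = t 0 := Fin.snoc_castSucc _ _ (0 : Fin (m + 1))
  rwa [dl_snoc, hv t htS, smul_zero, add_zero, e0, Coch.map,
    cone_snoc w (fun i => hS (htS.1 i)) hu] at h1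

end Nonvanish

/-! ### The weak diamond construction and the induction on the degree -/

section Step

variable {G K : Type*} [AddCommGroup G] [AddCommGroup K] {m : ℕ}

/-- If the twists exist at all points of cofinality `ω_m` that are closed under some function, then
the weak diamond yields a coherent family that is not trivial. -/
theorem exists_nontrivial_of_hasTwist [Countable K] {r : BaireMod → BaireMod → Prop} {φ : G →+ K}
    (hle : ∀ f g, r f g → f ≤ g) (hw : WeakDiamond (cofSet m)) {D : Wo m → Set BaireMod}
    (hD : Monotone D) (hDc : ∀ α, CardLE m (D α)) {T : Wo m → Set BaireMod}
    (hTc : ∀ α, (T α).Countable) (hTD : ∀ α, T α ⊆ ideal (D α)) (h : Wo m → Wo m)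
    (htwist : ∀ α ∈ cofSet m, (∀ β < α, h β < α) → ∃ u ∈ T α,
      HasTwist r φ m (⋃ β ∈ Set.Iio α, ideal (D β)) (⋃ β ∈ Set.Iio α, T β) u) :
    ∃ x : Coch G (m + 1), EqMod (· ≤ ·) (⋃ α, ideal (D α)) (dl x) 0 ∧
      ¬ ∃ y : Coch K m, EqMod r (⋃ β, T β) (Coch.map φ x) (dl y) := by
  classical
  set P : Wo m → Set BaireMod := fun α => ⋃ β ∈ Set.Iio α, ideal (D β) with hPdef
  set S : Wo m → Set BaireMod := fun α => ⋃ β ∈ Set.Iio α, T β with hSdef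
  have hlow : ∀ α, IsLowerSet (ideal (D α)) := fun α => isLowerSet_ideal _
  have hPlow : ∀ α, IsLowerSet (P α) := fun α =>
    isLowerSet_iUnion fun β => isLowerSet_iUnion fun _ => hlow β
  have hPtriv : ∀ α, Triv G m (P α) := by
    intro α
    rcases (Set.Iio α).eq_empty_or_nonempty with he | he
    · rw [hPdef]
      dsimp only
      rw [he, Set.biUnion_empty]
      exact triv_empty
    · rw [hPdef]
      dsimp only
      rw [biUnion_ideal hD he]
      exact triv_ideal le_rfl ((Wo.cardLE_Iio α).biUnion fun β _ => hDc β)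
  have hz : ∀ α, ∃ z : Coch G (m + 1), ∃ u : BaireMod,
      EqMod (· ≤ ·) Set.univ (dl z) 0 ∧ EqMod (· ≤ ·) (P α) z 0 ∧
      (α ∈ cofSet m → (∀ β < α, h β < α) → u ∈ T α ∧
        ¬ ∃ v : Coch K m, (∀ s, Tup r (S α) s → v s = 0) ∧
          EqMod r (insert u (S α)) (Coch.map φ z) (dl v)) := by
    intro α
    by_cases hα : α ∈ cofSet m ∧ ∀ β < α, h β < α
    · obtain ⟨u, hu, w, hw, hv⟩ := htwist α hα.1 hα.2
      refine ⟨cone (P α) w, u, dl_cone (hPlow α) hw, fun t ht => ?_, fun _ _ => ⟨hu, hv⟩⟩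
      rw [cone_of_last_mem w (ht.1 _), Pi.zero_apply, sub_zero]
      exact zero_mem _
    · refine ⟨0, joinF ∅, ?_, EqMod.refl _, fun h1 h2 => absurd ⟨h1, h2⟩ hα⟩
      rw [map_zero]
      exact EqMod.refl _
  choose z u hz0 hzP hzu using hz
  have hY : ∀ α (U : Coch G (m + 1)), ∃ y : Coch G m,
      EqMod (· ≤ ·) (P α) (dl U) 0 → EqMod (· ≤ ·) (P α) U (dl y) := by
    intro α U
    by_cases hU : EqMod (· ≤ ·) (P α) (dl U) 0
    · obtain ⟨y, hy⟩ := hPtriv α U hU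
      exact ⟨y, fun _ => hy⟩
    · exact ⟨0, fun h => absurd h hU⟩
  choose Y hY using hY
  -- `Y` and `z` are fixed in advance; the set `g` only decides at which stages the twist is added.
  -- As `z α` is null on `P α`, both choices extend the earlier stages.
  let Φ : Set (Wo m) → Wo m → Coch G (m + 1) → Coch G (m + 1) := fun g α U =>
    dl (Y α U) + if α ∈ g then z α else 0
  have hite : ∀ (g : Set (Wo m)) (α : Wo m), EqMod (· ≤ ·) Set.univ (dl (if α ∈ g then z α else 0)) 0 := by
    intro g α
    split_ifs
    · exact hz0 α
    · rw [map_zero]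
      exact EqMod.refl _
  have hiteP : ∀ (g : Set (Wo m)) (α : Wo m), EqMod (· ≤ ·) (P α) (if α ∈ g then z α else 0) 0 := by
    intro g α
    split_ifs
    · exact hzP α
    · exact EqMod.refl _
  have hΦ : ∀ g α U, EqMod (· ≤ ·) (P α) (dl U) 0 →
      EqMod (· ≤ ·) (P α) (Φ g α U) U ∧ EqMod (· ≤ ·) (ideal (D α)) (dl (Φ g α U)) 0 := by
    intro g α U hU
    constructor
    · have := (hY α U hU).symm.add (hiteP g α)
      rwa [add_zero] at this
    · change EqMod _ _ (dl (dl (Y α U) + _)) 0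
      rw [map_add, dl_dl, zero_add]
      exact (hite g α).mono (Set.subset_univ _)
  let R : Wo m → Set BaireMod := fun α => ideal (D α)
  let U : Set (Wo m) → Wo m → Coch G (m + 1) := fun g α => glue R (stage R (Φ g)) (Set.Iio α)
  have hUcongr : ∀ g g' α, (∀ β < α, β ∈ g ↔ β ∈ g') → U g α = U g' α := by
    intro g g' α hg
    refine glue_stage_congr R α fun β hβ => ?_
    funext V
    change dl (Y β V) + _ = dl (Y β V) + _
    simp only [hg β hβ]
  -- A subset of `B` codes a set of stages together with the graph of a `K`-valued `m`-cochain.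
  -- Countability of `K` and of the levels `T γ` keeps each `V β` of size at most `ℵ_m`.
  let B := Wo m ⊕ ((Fin m → BaireMod) × (ℕ × ℕ) × K)
  let V : Wo m → Set B := fun β => (Sum.inl '' {β}) ∪
    (Sum.inr '' ({t : Fin m → BaireMod | ∀ i, t i ∈ ⋃ γ ∈ Set.Iic β, T γ} ×ˢ Set.univ))
  have hV : ∀ β, CardLE m (V β) := by
    intro β
    refine (CardLE.of_countable ((Set.countable_singleton β).image _)).union (CardLE.image ?_ _)
    refine CardLE.prod ?_ (CardLE.of_countable (Set.to_countable _))
    exact ((Wo.cardLE_Iic β).biUnion fun γ _ => CardLE.of_countable (hTc γ)).tuples m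
  let gdec : Set B → Set (Wo m) := fun b => {β | Sum.inl β ∈ b}
  let ydec : Set B → Coch K m := fun b t p =>
    if hk : ∃ k, Sum.inr (t, p, k) ∈ b then hk.choose else 0
  -- The guessed statement: the coded trivialization below `α` extends to `u α` when no twist is
  -- added. Then `α ∈ g` means that the twist is added exactly when the untwisted extension is
  -- possible.
  obtain ⟨g, hg⟩ := hw.exists_guess hV h fun α b =>
    ∃ y' : Coch K m, (∀ t, Tup r (S α) t → y' t = ydec b t) ∧
      EqMod r (insert (u α) (S α)) (Coch.map φ (dl (Y α (U (gdec b) α)))) (dl y')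
  refine ⟨glue R (stage R (Φ g)) Set.univ, ?_, ?_⟩
  · have := dl_glue_stage hlow (hΦ g) Set.univ
    rwa [Set.biUnion_univ] at this
  rintro ⟨y, hy⟩
  let b : Set B := (Sum.inl '' g) ∪ (Sum.inr '' {q | y q.1 q.2.1 = q.2.2})
  obtain ⟨α, hα, hcl, hgα⟩ := hg b
  obtain ⟨huT, hnov⟩ := hzu α hα hcl
  have hU1 : U (gdec (b ∩ ⋃ β ∈ Set.Iio α, V β)) α = U g α := by
    refine hUcongr _ _ _ fun β hβ => ?_
    constructor
    · rintro ⟨h1 | h1, -⟩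
      · obtain ⟨_, h2, h3⟩ := h1
        exact Sum.inl.inj h3 ▸ h2
      · obtain ⟨_, _, h3⟩ := h1
        cases h3
    · exact fun h1 => ⟨Or.inl ⟨β, h1, rfl⟩, Set.mem_iUnion₂.2 ⟨β, hβ, Or.inl ⟨β, rfl, rfl⟩⟩⟩
  have hvis : ∀ t : Fin m → BaireMod, (∀ i, t i ∈ S α) →
      ∃ β < α, ∀ i, t i ∈ ⋃ γ ∈ Set.Iic β, T γ := by
    intro t ht
    have h1 : ∀ i, ∃ β, β < α ∧ t i ∈ T β := fun i => by
      obtain ⟨β, hβ, h⟩ := Set.mem_iUnion₂.1 (ht i)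
      exact ⟨β, hβ, h⟩
    choose c hc hc' using h1
    -- For `m = 0` the empty tuple must also be visible at some stage below `α`, which uses that `α`
    -- is not least.
    rcases isEmpty_or_nonempty (Fin m) with he | he
    · obtain ⟨β₀, hβ₀⟩ := Wo.nonempty_Iio hα
      exact ⟨β₀, hβ₀, fun i => he.elim i⟩
    · obtain ⟨i₀, hi₀⟩ := Finite.exists_max c
      exact ⟨c i₀, hc i₀, fun i => Set.mem_iUnion₂.2 ⟨c i, hi₀ i, hc' i⟩⟩
  have hy1 : ∀ t, Tup r (S α) t → ydec (b ∩ ⋃ β ∈ Set.Iio α, V β) t = y t := by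
    intro t ht
    funext p
    obtain ⟨β, hβ, ht'⟩ := hvis t ht.1
    have hex : ∃ k, Sum.inr (t, p, k) ∈ b ∩ ⋃ β ∈ Set.Iio α, V β :=
      ⟨y t p, Or.inr ⟨_, rfl, rfl⟩, Set.mem_iUnion₂.2 ⟨β, hβ, Or.inr ⟨(t, p, y t p), ⟨ht', trivial⟩, rfl⟩⟩⟩
    change (if hk : _ then _ else _) = _
    rw [dif_pos hex]
    obtain ⟨h1 | h1, -⟩ := hex.choose_spec
    · obtain ⟨_, _, h3⟩ := h1
      cases h3
    · obtain ⟨q, hq, h3⟩ := h1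
      have h4 := Sum.inr.inj h3
      generalize hex.choose = k at h4
      subst h4
      exact hq.symm
  have hsub : insert (u α) (S α) ⊆ ⋃ β, T β := by
    refine Set.insert_subset (Set.mem_iUnion.2 ⟨α, huT⟩) ?_
    exact Set.iUnion₂_subset fun β _ => Set.subset_iUnion T β
  have hsubR : insert (u α) (S α) ⊆ R α := by
    refine Set.insert_subset (hTD α huT) (Set.iUnion₂_subset fun β hβ => ?_)
    exact (hTD β).trans (ideal_mono (hD (le_of_lt hβ)))
  have hx : EqMod r (insert (u α) (S α)) (dl y)
      (Coch.map φ (dl (Y α (U g α))) + Coch.map φ (if α ∈ g then z α else 0)) := by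
    have h1 : EqMod (· ≤ ·) (R α) (glue R (stage R (Φ g)) Set.univ) (stage R (Φ g) α) :=
      glue_eqMod (fun β _ γ _ hγ => (stage_spec hlow (hΦ g) β).1 γ hγ) (Set.mem_univ α)
    rw [stage_eq] at h1
    have h2 : EqMod r (R α) (Coch.map φ (glue R (stage R (Φ g)) Set.univ))
        (Coch.map φ (Φ g α (U g α))) := fun t ht => (h1.map φ) t (ht.imp hle)
    have h3 := (hy.mono hsub).symm.trans (h2.mono hsubR)
    have e : Coch.map φ (Φ g α (U g α)) =
        Coch.map φ (dl (Y α (U g α))) + Coch.map φ (if α ∈ g then z α else 0) :=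
      funext fun t => map_add (φ.compLeft _) _ _
    rwa [e] at h3
  have hzero : Coch.map φ (0 : Coch G (m + 1)) = 0 := funext fun t => map_zero (φ.compLeft _)
  rw [hU1] at hgα
  -- If the twist was added, `y` and the guessed extension `y'` agree below `α`, and their
  -- difference absorbs the twist. If it was not, `y` itself is an untwisted extension, which forces
  -- `α ∈ g`.
  by_cases hmem : α ∈ g
  · obtain ⟨y', hy', hyE⟩ := hgα.1 hmem
    refine hnov ⟨y - y', fun s hs => ?_, ?_⟩
    · rw [Pi.sub_apply, hy' s hs, hy1 s hs, sub_self]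
    · rw [if_pos hmem] at hx
      have := (hx.sub hyE.symm).symm
      rwa [add_sub_cancel_left, ← map_sub] at this
  · rw [if_neg hmem, hzero, add_zero] at hx
    exact hmem (hgα.2 ⟨y, fun t ht => (hy1 t ht).symm, hx.symm⟩)

/-- The ideal is filtered by its generators together with the test levels. The closure condition on
`α` ensures that the levels below `α` are already unbounded in the ideal generated below `α`. -/
theorem nonvanishing_of_forall_hasTwist [Countable K] {r : BaireMod → BaireMod → Prop} {φ : G →+ K}
    (hr : FinerOrder r) (hw : WeakDiamond (cofSet m))
    (htw : ∀ (A : Set BaireMod) (T : Wo m → Set BaireMod) (α : Wo m), α ∈ cofSet m → CardLE m A →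
      (∀ β < α, (T β).Countable ∧ (T β).Nonempty ∧ T β ⊆ ideal A) →
      (∀ β γ, β < γ → ∀ u ∈ T γ, ∃ t ∈ T β, r t u) →
      (∀ p ∈ ideal A, ∃ β < α, ∀ t ∈ T β, ¬ t ≤ p) →
      ∀ u ∈ T α, HasTwist r φ m (ideal A) (⋃ β ∈ Set.Iio α, T β) u) :
    Nonvanishing r φ m := by
  intro A T hA hT
  obtain ⟨a, -, ha⟩ := exists_range_ideal_eq hA (Wo.mk_eq m).ge
  let D : Wo m → Set BaireMod := fun α => (a '' Set.Iic α) ∪ ⋃ β ∈ Set.Iic α, T β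
  have hD : Monotone D := fun α β hαβ => Set.union_subset_union
    (Set.image_mono (Set.Iic_subset_Iic.2 hαβ))
    (Set.biUnion_subset_biUnion_left (Set.Iic_subset_Iic.2 hαβ))
  have hDc : ∀ α, CardLE m (D α) := fun α => ((Wo.cardLE_Iic α).image a).union
    ((Wo.cardLE_Iic α).biUnion fun β _ => CardLE.of_countable (hT.countable β))
  have hTD : ∀ α, T α ⊆ D α := fun α =>
    (Set.subset_biUnion_of_mem (u := T) (Set.mem_Iic.2 le_rfl)).trans Set.subset_union_right
  have hDA : ∀ α, ideal (D α) ⊆ ideal A := fun α => by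
    refine ideal_subset_ideal (Set.union_subset ?_ (Set.iUnion₂_subset fun β _ => hT.subset β))
    rw [← ha]
    exact (Set.image_subset_range _ _).trans (subset_ideal _)
  -- `D β` has at most `ℵ_m` finite subsets. For each, some level has no member below the join; a
  -- `γ` above all these levels inherits this, since its members lie above members of each lower
  -- level.
  have hun : ∀ β, ∃ γ, ∀ p ∈ ideal (D β), ∀ t ∈ T γ, ¬ t ≤ p := by
    intro β
    have h1 : ∀ s : Finset BaireMod, ∃ γ, ↑s ⊆ D β → ∀ t ∈ T γ, ¬ t ≤ joinF s := by
      intro s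
      by_cases hs : ↑s ⊆ D β
      · obtain ⟨γ, hγ⟩ := hT.unbounded _ (hDA β (joinF_mem_ideal hs))
        exact ⟨γ, fun _ => hγ⟩
      · exact ⟨β, fun h => absurd h hs⟩
    choose c hc using h1
    obtain ⟨γ, hγ⟩ := Wo.exists_gt (hDc β).finsets c
    refine ⟨γ, ?_⟩
    rintro p ⟨s, hs, hp⟩ t ht htp
    obtain ⟨t', ht', htt'⟩ := hT.exists_rel _ _ (hγ s hs) t ht
    exact hc s hs t' ht' ((hr.le _ _ htt').trans (htp.trans hp))
  choose h hh using hun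
  have hcover : ⋃ α, ideal (D α) = ideal A := by
    refine (Set.iUnion_subset hDA).antisymm ?_
    have e := biUnion_ideal hD (Set.univ_nonempty (α := Wo m))
    rw [Set.biUnion_univ, Set.biUnion_univ] at e
    rw [e, ← ha]
    refine ideal_mono ?_
    rintro _ ⟨β, rfl⟩
    exact Set.mem_iUnion.2 ⟨β, Or.inl ⟨β, Set.mem_Iic.2 le_rfl, rfl⟩⟩
  rw [← hcover]
  refine exists_nontrivial_of_hasTwist hr.le hw hD hDc hT.countable
    (fun α => (hTD α).trans (subset_ideal _)) h fun α hα hcl => ?_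
  obtain ⟨u, hu⟩ := hT.nonempty α
  refine ⟨u, hu, ?_⟩
  have hP := biUnion_ideal hD (Wo.nonempty_Iio hα)
  rw [hP]
  refine htw _ T α hα ((Wo.cardLE_Iio α).biUnion fun β _ => hDc β)
    (fun β hβ => ⟨hT.countable β, hT.nonempty β, ?_⟩) hT.exists_rel (fun p hp => ?_) u hu
  · exact (hTD β).trans ((Set.subset_biUnion_of_mem (u := D) hβ).trans (subset_ideal _))
  · rw [← hP] at hp
    obtain ⟨β, hβ, hp⟩ := Set.mem_iUnion₂.1 hp
    exact ⟨h β, hcl β hβ, hh β p hp⟩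

/-- Induction on `m`: the twist needed at a point of cofinality `ω_{m+1}` is a family given by the
previous degree. -/
theorem nonvanishing [Countable K] {r : BaireMod → BaireMod → Prop} {φ : G →+ K}
    (hr : FinerOrder r) (hφ : φ ≠ 0) (hw : ∀ k ≤ m, WeakDiamond (cofSet k)) :
    Nonvanishing r φ m := by
  have notMem : ∀ {m : ℕ} {A : Set BaireMod} {T : Wo m → Set BaireMod} {α : Wo m},
      (∀ β γ, β < γ → ∀ u ∈ T γ, ∃ t ∈ T β, r t u) →
      (∀ p ∈ ideal A, ∃ β < α, ∀ t ∈ T β, ¬ t ≤ p) → ∀ u ∈ T α, u ∉ ideal A := by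
    intro m A T α h1 h2 u hu huA
    obtain ⟨β, hβ, h⟩ := h2 u huA
    obtain ⟨t, ht, htu⟩ := h1 β α hβ u hu
    exact h t ht (hr.le _ _ htu)
  induction m with
  | zero =>
    refine nonvanishing_of_forall_hasTwist hr (hw 0 le_rfl) fun A T α hα hA h0 h1 h2 u hu => ?_
    refine hasTwist_zero hr hφ ?_ (notMem h1 h2 u hu)
    have : Cardinal.mk A ≤ ℵ_ ((0 : ℕ) : Ordinal.{0}) := hA
    rwa [Nat.cast_zero, Cardinal.aleph_zero, Cardinal.le_aleph0_iff_set_countable] at this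
  | succ m ih =>
    have hN := ih fun k hk => hw k (hk.trans m.le_succ)
    refine nonvanishing_of_forall_hasTwist hr (hw _ le_rfl) fun A T α hα hA h0 h1 h2 u hu => ?_
    obtain ⟨e, he, heα, hcof⟩ := Wo.exists_cofinal hα
    -- The levels are thinned along a cofinal sequence in `α` and cut down to members `r`-below `u`,
    -- so that `(t, u)` is again an `r`-increasing tuple. Coinitiality keeps the cut levels nonempty
    -- and coinitial in one another.
    refine hasTwist_succ hr hN hA (T := fun ξ => {t ∈ T (e ξ) | r t u}) ?_
      (Set.iUnion₂_subset fun β hβ => (h0 β hβ).2.2) (fun ξ t ht => ?_) (fun ξ t ht => ht.2)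
      (notMem h1 h2 u hu)
    · refine ⟨fun ξ => (h0 _ (heα ξ)).1.mono fun t ht => ht.1, fun ξ => ?_,
        fun ξ t ht => (h0 _ (heα ξ)).2.2 ht.1, fun ξ η hξη v hv => ?_, fun p hp => ?_⟩
      · obtain ⟨t, ht, htu⟩ := h1 _ _ (heα ξ) u hu
        exact ⟨t, ht, htu⟩
      · obtain ⟨t, ht, htv⟩ := h1 _ _ (he hξη) v hv.1
        exact ⟨t, ⟨ht, hr.trans _ _ _ htv hv.2⟩, htv⟩
      · obtain ⟨β, hβ, hβ'⟩ := h2 p hp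
        obtain ⟨ξ, hξ⟩ := hcof β hβ
        refine ⟨ξ, fun t ht htp => ?_⟩
        rcases hξ.eq_or_lt with e1 | hlt
        · exact hβ' t (e1 ▸ ht.1) htp
        · obtain ⟨t', ht', htt'⟩ := h1 _ _ hlt t ht.1
          exact hβ' t' ht' ((hr.le _ _ htt').trans htp)
    · exact Set.mem_iUnion₂.2 ⟨e ξ, heα ξ, ht.1⟩

end Step

/-! ### Families of functions modulo finite -/

section Families

variable {G : Type u} [AddCommGroup G]

/-- The class modulo finite of the restriction of a function to the points below `f`. -/
def classOf (G : Type u) [AddCommGroup G] (f : BaireMod) : (ℕ × ℕ → G) →+ QGroup G f where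
  toFun h := QuotientAddGroup.mk fun p => h p.1
  map_zero' := rfl
  map_add' _ _ := rfl

theorem classOf_surjective (f : BaireMod) : Function.Surjective (classOf G f) := by
  intro q
  obtain ⟨x, rfl⟩ := QuotientAddGroup.mk_surjective q
  refine ⟨fun p => if h : p.2 < f p.1 then x ⟨p, h⟩ else 0, ?_⟩
  refine congrArg QuotientAddGroup.mk ?_
  funext p
  exact dif_pos p.2

theorem mem_AGroup_iff {f : BaireMod} {h : ℕ × ℕ → G} :
    (fun p : Region f => h p.1) ∈ AGroup G f ↔ h ∈ null G f := by
  have e : {p : ℕ × ℕ | p.2 < f p.1 ∧ h p ≠ 0} =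
      Subtype.val '' (Function.support fun p : Region f => h p.1) := by
    ext p
    constructor
    · rintro ⟨h1, h2⟩
      exact ⟨⟨p, h1⟩, h2, rfl⟩
    · rintro ⟨q, hq, rfl⟩
      exact ⟨q.2, hq⟩
  rw [mem_null, e, Set.finite_image_iff Subtype.val_injective.injOn]
  rfl

theorem classOf_eq_zero {f : BaireMod} {h : ℕ × ℕ → G} : classOf G f h = 0 ↔ h ∈ null G f :=
  (QuotientAddGroup.eq_zero_iff _).trans mem_AGroup_iff

theorem restrictQ_classOf {f g : BaireMod} (hfg : f ≤ g) (h : ℕ × ℕ → G) :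
    restrictQ G f g (classOf G g h) = classOf G f h := by
  refine QuotientAddGroup.eq.2 ((finite_region_diff hfg).subset fun p hp => ?_)
  by_contra hc
  have hp2 : p.1.2 < g p.1.1 := not_not.1 hc
  refine hp ?_
  have e : restrictB G f g (fun q : Region g => h q.1) p = h p.1 := dif_pos hp2
  change - restrictB G f g (fun q : Region g => h q.1) p + h p.1 = 0
  rw [e, neg_add_cancel]

/-- The cochain `x` represents the family `X` of functions modulo finite. -/
def Represents {P : Set BaireMod} {n : ℕ} (x : Coch G (n + 1))
    (X : RoosCochain (QSystemOn G P) n) : Prop :=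
  ∀ t : Fin (n + 1) →o P, X t = classOf G (t 0).1 (x fun i => (t i).1)

theorem Represents.roosCoboundary {P : Set BaireMod} {n : ℕ} {x : Coch G (n + 1)}
    {X : RoosCochain (QSystemOn G P) n} (h : Represents x X) :
    Represents (dl x) (roosCoboundary (QSystemOn G P) n X) := by
  intro t
  have e : classOf G (t 0).1 (dl x fun i => (t i).1) = ∑ i : Fin (n + 2),
      (-1 : ℤ) ^ (i : ℕ) • classOf G (t 0).1 (x fun j => (face t i j).1) := by
    rw [dl_apply, map_sum]
    exact Finset.sum_congr rfl fun i _ => map_zsmul _ _ _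
  refine Eq.trans ?_ e.symm
  change (∑ i : Fin (n + 2), (-1 : ℤ) ^ (i : ℕ) •
    restrictQ G (t 0).1 (face t i 0).1 (X (face t i))) = _
  refine Finset.sum_congr rfl fun i _ =>
    congrArg (fun q : QGroup G (t 0).1 => (-1 : ℤ) ^ (i : ℕ) • q) ?_
  exact (congrArg (restrictQ G (t 0).1 (face t i 0).1) (h (face t i))).trans
    (restrictQ_classOf (zero_le_face_zero t i) _)

theorem tup_orderHom {P : Set BaireMod} {n : ℕ} (t : Fin n →o P) :
    Tup (· ≤ ·) P fun i => (t i).1 :=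
  ⟨fun i => (t i).2, fun _ _ hij => t.monotone hij⟩

theorem exists_represents {P : Set BaireMod} {n : ℕ} (X : RoosCochain (QSystemOn G P) n) :
    ∃ x : Coch G (n + 1), Represents x X := by
  have key : ∀ t : Fin (n + 1) → BaireMod, ∃ h : ℕ × ℕ → G,
      ∀ ht : Tup (· ≤ ·) P t, X ⟨fun i => ⟨t i, ht.1 i⟩, fun i j hij => ht.2 i j hij⟩ =
        classOf G (t 0) h := by
    intro t
    by_cases ht : Tup (· ≤ ·) P t
    · obtain ⟨h, hh⟩ := classOf_surjective (t 0)
        (X ⟨fun i => ⟨t i, ht.1 i⟩, fun i j hij => ht.2 i j hij⟩)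
      exact ⟨h, fun _ => hh.symm⟩
    · exact ⟨0, fun h => absurd h ht⟩
  choose x hx using key
  exact ⟨x, fun t => hx _ (tup_orderHom t)⟩

/-- The family of functions modulo finite represented by a cochain. -/
def Coch.toFamily {n : ℕ} (x : Coch G (n + 1)) (P : Set BaireMod) :
    RoosCochain (QSystemOn G P) n :=
  fun t => classOf G (t 0).1 (x fun i => (t i).1)

theorem exists_eqMod_of_isTrivial {C : Set BaireMod} {m : ℕ} {x : Coch G (m + 1)}
    (h : IsTrivial (n := m + 1) (restrict (Set.subset_univ C)
      (show Family G Set.univ (m + 1) from x.toFamily Set.univ))) :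
    ∃ y : Coch G m, EqMod (· ≤ ·) C x (dl y) := by
  obtain ⟨Y, hY⟩ := h
  have hx : ∀ (t : Fin (m + 1) → BaireMod) (ht : Tup (· ≤ ·) C t) (z : ℕ × ℕ → G),
      coboundary G C m Y ⟨fun i => ⟨t i, ht.1 i⟩, fun i j hij => ht.2 i j hij⟩ =
        classOf G (t 0) z → x t - z ∈ null G (t 0) := by
    intro t ht z hz
    rw [hY] at hz
    rw [← classOf_eq_zero, map_sub, sub_eq_zero]
    exact hz
  cases m with
  | zero =>
    let ψ : ℕ × ℕ → G := Y
    refine ⟨fun _ => ψ, fun t ht => hx t ht _ ?_⟩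
    have e : dl (fun _ : Fin 0 → BaireMod => ψ) t = ψ := by
      rw [dl_apply]
      simp
    rw [e]
    rfl
  | succ m =>
    obtain ⟨y, hy⟩ := exists_represents (P := C) Y
    exact ⟨y, fun t ht => hx t ht _ (hy.roosCoboundary _)⟩

end Families

/-! ### From families on `(ω^ω, ≤*)` to the Roos complex of `𝐀_G` -/

section RoosA

variable {G : Type u} [AddCommGroup G]

/-- The relation of everywhere domination. -/
def DomLE (f g : BaireMod) : Prop := ∀ i, f i ≤ g i

theorem finerOrder_domLE : FinerOrder DomLE where
  refl _ _ := le_rfl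
  trans _ _ _ h h' i := (h i).trans (h' i)
  le f g h := by
    have : {i : ℕ | ¬ f i ≤ g i} = ∅ := by
      ext i
      simpa using h i
    change Set.Finite {i : ℕ | ¬ f i ≤ g i}
    rw [this]
    exact Set.finite_empty

theorem roosCoboundary_ASystem {n : ℕ} {x : Coch G (n + 1)} {X : RoosCochain (ASystem G) n}
    (h : ∀ (t : Fin (n + 1) →o Baire) (p : Region (t 0)), (X t).1 p = x t p.1)
    (t : Fin (n + 2) →o Baire) (p : Region (t 0)) :
    (roosCoboundary (ASystem G) n X t).1 p = dl x t p.1 := by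
  let ev : AGroup G (t 0) →+ G := (Pi.evalAddMonoidHom (fun _ : Region (t 0) => G) p).comp
    (AGroup G (t 0)).subtype
  have e : dl x t p.1 = ∑ i : Fin (n + 2), (-1 : ℤ) ^ (i : ℕ) • x (face t i) p.1 := by
    refine (congrFun (dl_apply x _) p.1).trans (Finset.sum_apply _ _ _)
  refine ((map_sum ev _ _).trans ?_).trans e.symm
  refine Finset.sum_congr rfl fun i _ => ?_
  refine (map_zsmul ev _ _).trans (congrArg _ ?_)
  have hp : p.1.2 < face t i 0 p.1.1 := p.2.trans_le (zero_le_face_zero t i p.1.1)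
  have e : ev ((ASystem G).map (homOfLE (zero_le_face_zero t i)).op (X (face t i))) =
      (X (face t i)).1 ⟨p.1, hp⟩ := dif_pos hp
  exact e.trans (h _ _)

theorem tup_domLE {n : ℕ} (t : Fin n →o Baire) : Tup DomLE Set.univ (t : Fin n → BaireMod) :=
  ⟨fun _ => trivial, fun _ _ hij => t.monotone hij⟩

/-- A coherent family on `(ω^ω, ≤*)` is trivial on `(ω^ω, ≤)` if the Roos complex of `𝐀_G` is exact
in the next degree. -/
theorem exists_eqMod_of_roos_exact {m : ℕ}
    (hex : ∀ X : RoosCochain (ASystem G) (m + 1), roosCoboundary (ASystem G) (m + 1) X = 0 →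
      ∃ a, roosCoboundary (ASystem G) m a = X)
    {x : Coch G (m + 1)} (hx : EqMod (· ≤ ·) Set.univ (dl x) 0) :
    ∃ b : Coch G m, EqMod DomLE Set.univ x (dl b) := by
  classical
  -- The coboundary of `x` has finite support below `t 0`, hence is a cocycle of `𝐀_G`. Subtracting
  -- a primitive `a` turns `x` into an exact cocycle of functions, not merely a cocycle modulo
  -- finite.
  let X : RoosCochain (ASystem G) (m + 1) := fun t => ⟨fun p => dl x t p.1, by
    have h : dl x t - 0 ∈ null G (t 0) := hx t ((tup_domLE t).imp finerOrder_domLE.le)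
    rw [sub_zero] at h
    exact mem_AGroup_iff.2 h⟩
  have hX : ∀ (t : Fin (m + 2) →o Baire) (p : Region (t 0)), (X t).1 p = dl x t p.1 :=
    fun _ _ => rfl
  obtain ⟨a, ha⟩ := hex X (by
    funext t
    refine Subtype.ext (funext fun p => ?_)
    rw [roosCoboundary_ASystem hX, dl_dl]
    rfl)
  let aExt : Coch G (m + 1) := fun t p =>
    if h : (∀ i j, i ≤ j → DomLE (t i) (t j)) ∧ p.2 < t 0 p.1 then
      (a ⟨t, fun i j hij => h.1 i j hij⟩).1 ⟨p, h.2⟩ else 0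
  have haExt : ∀ (t : Fin (m + 1) →o Baire) (p : Region (t 0)), (a t).1 p = aExt t p.1 := fun t p => by
    have hc : (∀ i j, i ≤ j → DomLE (t i) (t j)) ∧ p.1.2 < t 0 p.1.1 := ⟨(tup_domLE t).2, p.2⟩
    symm
    exact dif_pos hc
  have hnull : ∀ t, Tup DomLE Set.univ t → aExt t ∈ null G (t 0) := fun t ht => by
    have h := (a ⟨t, fun i j hij => ht.2 i j hij⟩).2
    have e : (fun p : Region (t 0) => aExt t p.1) = (a ⟨t, fun i j hij => ht.2 i j hij⟩).1 :=
      funext fun p => (haExt ⟨t, fun i j hij => ht.2 i j hij⟩ p).symm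
    rw [← mem_AGroup_iff, e]
    exact h
  have hdl : ∀ t, Tup DomLE Set.univ t → ∀ p : ℕ × ℕ, p.2 < t 0 p.1 → dl (x - aExt) t p = 0 := by
    intro t ht p hp
    have h := roosCoboundary_ASystem haExt ⟨t, fun i j hij => ht.2 i j hij⟩ ⟨p, hp⟩
    rw [ha] at h
    rw [map_sub, Pi.sub_apply, Pi.sub_apply, sub_eq_zero]
    exact h
  -- `e p` is the least function whose graph lies above `p`, so `e p ≤ t 0` everywhere as soon as
  -- `p` is below `t 0`. Prepending it contracts the complex of full functions pointwise at `p`.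
  let e : ℕ × ℕ → BaireMod := fun p i => if i = p.1 then p.2 + 1 else 0
  refine ⟨fun s p => (x - aExt) (Fin.cons (e p) s) p, fun t ht => ?_⟩
  have hagree : ∀ p : ℕ × ℕ, p.2 < t 0 p.1 →
      (x - aExt) t p = dl (fun s p => (x - aExt) (Fin.cons (e p) s) p) t p := by
    intro p hp
    have hle : ∀ i, DomLE (e p) (t i) := by
      intro i k
      refine le_trans ?_ (ht.2 0 i (Fin.zero_le _) k)
      change (if k = p.1 then p.2 + 1 else 0) ≤ t 0 k
      split_ifs with hk
      · rw [hk]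
        exact hp
      · exact Nat.zero_le _
    have hcons : Tup DomLE Set.univ (Fin.cons (e p) t : Fin (m + 2) → BaireMod) := by
      refine ⟨fun _ => trivial, fun i j => ?_⟩
      refine Fin.cases ?_ (fun i => ?_) i <;> refine Fin.cases ?_ (fun j => ?_) j
      · exact fun _ _ => le_rfl
      · exact fun _ => by simpa using hle j
      · exact fun h => absurd h (by simp)
      · intro h
        simpa using ht.2 i j (Fin.succ_le_succ_iff.1 h)
    have h := hdl _ hcons p (show p.2 < e p p.1 by simp [e])
    rw [dl_cons, Pi.sub_apply, sub_eq_zero] at h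
    rw [h, dl_apply, dl_apply, Finset.sum_apply, Finset.sum_apply]
    rfl
  refine (mem_null.1 (hnull t ht)).subset ?_
  rintro p ⟨hp, hp'⟩
  refine ⟨hp, fun h0 => hp' ?_⟩
  have h1 := hagree p hp
  rw [Pi.sub_apply, Pi.sub_apply, h0, sub_zero] at h1
  rw [Pi.sub_apply, h1, sub_self]

end RoosA

/-! ### The Roos complex detects the derived limits -/

section RoosDerived

variable {Λ : Type} [Preorder Λ] {F F' F'' : Λᵒᵖ ⥤ AddCommGrpCat.{u}}

theorem map_congr_tuple {n : ℕ} (X : RoosCochain F n) {s s' : Fin (n + 1) →o Λ} (h : s = s') {a : Λ}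
    (h1 : a ≤ s 0) (h2 : a ≤ s' 0) :
    F.map (homOfLE h1).op (X s) = F.map (homOfLE h2).op (X s') := by
  subst h
  rfl

theorem map_map_apply {a b c : Λ} (h1 : a ≤ b) (h2 : b ≤ c) (x : F.obj (op c)) :
    F.map (homOfLE h1).op (F.map (homOfLE h2).op x) = F.map (homOfLE (h1.trans h2)).op x := by
  rw [← ConcreteCategory.comp_apply, ← F.map_comp]
  rfl

theorem map_self_apply {a : Λ} (h : a ≤ a) (x : F.obj (op a)) : F.map (homOfLE h).op x = x := by
  have : (homOfLE h).op = 𝟙 (op a) := rfl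
  rw [this, F.map_id]
  rfl

theorem roosCoboundary_apply {n : ℕ} (X : RoosCochain F n) (t : Fin (n + 2) →o Λ) :
    roosCoboundary F n X t = ∑ i : Fin (n + 2),
      (-1 : ℤ) ^ (i : ℕ) • F.map (homOfLE (zero_le_face_zero t i)).op (X (face t i)) := rfl

theorem roosCoboundary_roosCoboundary {n : ℕ} (X : RoosCochain F n) :
    roosCoboundary F (n + 1) (roosCoboundary F n X) = 0 := by
  funext t
  have hle : ∀ i j, t 0 ≤ face (face t i) j 0 := fun i j =>
    (zero_le_face_zero t i).trans (zero_le_face_zero _ j)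
  have e : roosCoboundary F (n + 1) (roosCoboundary F n X) t = ∑ i : Fin (n + 3),
      (-1 : ℤ) ^ (i : ℕ) • ∑ j : Fin (n + 2), (-1 : ℤ) ^ (j : ℕ) •
        F.map (homOfLE (hle i j)).op (X (face (face t i) j)) := by
    rw [roosCoboundary_apply]
    refine Finset.sum_congr rfl fun i _ => ?_
    rw [roosCoboundary_apply, map_sum]
    congr 1
    refine Finset.sum_congr rfl fun j _ => ?_
    rw [map_zsmul, map_map_apply]
  rw [e]
  refine sum_sum_eq_zero_of_swap (fun i j => F.map (homOfLE (hle i j)).op (X (face (face t i) j)))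
    fun i j => map_congr_tuple X ?_ _ _
  refine OrderHom.ext _ _ (funext fun k => congrArg t ?_)
  exact Fin.succAbove_succAbove_succAbove_predAbove i j k

/-- The map of Roos cochains induced by a morphism of inverse systems. -/
def roosMap (η : F ⟶ F') (n : ℕ) : RoosCochain F n →+ RoosCochain F' n where
  toFun X t := η.app (op (t 0)) (X t)
  map_zero' := by
    funext t
    simp
  map_add' x y := by
    funext t
    simp

theorem roosMap_apply (η : F ⟶ F') {n : ℕ} (X : RoosCochain F n) (t : Fin (n + 1) →o Λ) :
    roosMap η n X t = η.app (op (t 0)) (X t) := rfl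

theorem roosCoboundary_roosMap (η : F ⟶ F') {n : ℕ} (X : RoosCochain F n) :
    roosCoboundary F' n (roosMap η n X) = roosMap η (n + 1) (roosCoboundary F n X) := by
  funext t
  rw [roosMap_apply, roosCoboundary_apply, roosCoboundary_apply, map_sum]
  refine Finset.sum_congr rfl fun i _ => ?_
  rw [map_zsmul, roosMap_apply, NatTrans.naturality_apply]

theorem roosMap_roosMap (η : F ⟶ F') (θ : F' ⟶ F'') (h : η ≫ θ = 0) {n : ℕ}
    (X : RoosCochain F n) : roosMap θ n (roosMap η n X) = 0 := by
  funext t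
  rw [roosMap_apply, roosMap_apply, ← ConcreteCategory.comp_apply, ← NatTrans.comp_app, h]
  rfl

/-- The tuple `t` with `μ` put in front. -/
def consHom {n : ℕ} (μ : Λ) (t : Fin (n + 1) →o Λ) (h : μ ≤ t 0) : Fin (n + 2) →o Λ where
  toFun := Fin.cons μ t
  monotone' i j := by
    refine Fin.cases ?_ (fun i => ?_) i <;> refine Fin.cases ?_ (fun j => ?_) j
    · exact fun _ => le_rfl
    · exact fun _ => by simpa using h.trans (t.monotone (Fin.zero_le j))
    · exact fun h => absurd h (by simp)
    · intro h
      simpa using t.monotone (Fin.succ_le_succ_iff.1 h)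

theorem face_consHom_zero {n : ℕ} (μ : Λ) (t : Fin (n + 1) →o Λ) (h : μ ≤ t 0) :
    face (consHom μ t h) 0 = t :=
  OrderHom.ext _ _ rfl

theorem face_consHom_succ {n : ℕ} (μ : Λ) (t : Fin (n + 2) →o Λ) (h : μ ≤ t 0) (i : Fin (n + 2)) :
    face (consHom μ t h) i.succ = consHom μ (face t i) (h.trans (zero_le_face_zero t i)) := by
  refine OrderHom.ext _ _ (funext fun k => ?_)
  change (Fin.cons μ t : Fin (n + 3) → Λ) (i.succ.succAbove k) =
    (Fin.cons μ (face t i) : Fin (n + 2) → Λ) k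
  refine Fin.cases ?_ (fun k => ?_) k
  · simp
  · simp [face]

/-- The inverse system of the products `∏_{μ ≤ λ} F μ`. -/
def coind (F : Λᵒᵖ ⥤ AddCommGrpCat.{u}) : Λᵒᵖ ⥤ AddCommGrpCat.{u} where
  obj l := AddCommGrpCat.of (∀ μ : {μ : Λ // μ ≤ l.unop}, F.obj (op μ.1))
  map f := AddCommGrpCat.ofHom
    { toFun := fun x μ => x ⟨μ.1, μ.2.trans (leOfHom f.unop)⟩
      map_zero' := rfl
      map_add' := fun _ _ => rfl }
  map_id _ := rfl
  map_comp _ _ := rfl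

/-- The canonical embedding into the coinduced system. -/
def coindι (F : Λᵒᵖ ⥤ AddCommGrpCat.{u}) : F ⟶ coind F where
  app l := AddCommGrpCat.ofHom
    { toFun := fun x μ => F.map (homOfLE μ.2).op x
      map_zero' := by
        funext μ
        simp
      map_add' := fun x y => by
        funext μ
        simp }
  naturality _ _ f := by
    refine AddCommGrpCat.hom_ext (AddMonoidHom.ext fun x => ?_)
    funext μ
    exact map_map_apply (F := F) μ.2 (leOfHom f.unop) x

instance (F : Λᵒᵖ ⥤ AddCommGrpCat.{u}) : Mono (coindι F) := by
  have : ∀ l, Mono ((coindι F).app l) := fun l => by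
    rw [AddCommGrpCat.mono_iff_injective]
    intro x y hxy
    have h := congrFun hxy ⟨l.unop, le_rfl⟩
    have h' : F.map (homOfLE (le_refl l.unop)).op x = F.map (homOfLE (le_refl l.unop)).op y := h
    rwa [map_self_apply, map_self_apply] at h'
  exact NatTrans.mono_of_mono_app _

/-- In `coind F` the image of a cocycle is a coboundary, by prepending `μ` to tuples; injectivity
makes `F` a retract of `coind F`, which brings the primitive back to `F`. -/
theorem roos_exact_of_injective (F : Λᵒᵖ ⥤ AddCommGrpCat.{u}) [Injective F] {n : ℕ}
    (X : RoosCochain F (n + 1)) (hX : roosCoboundary F (n + 1) X = 0) :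
    ∃ a, roosCoboundary F n a = X := by
  let r : coind F ⟶ F := Injective.factorThru (𝟙 F) (coindι F)
  have hr : coindι F ≫ r = 𝟙 F := Injective.comp_factorThru _ _
  let y : RoosCochain (coind F) n := fun t μ => X (consHom μ.1 t μ.2)
  have key : roosCoboundary (coind F) n y = roosMap (coindι F) (n + 1) X := by
    funext t
    refine funext fun (μ : {μ : Λ // μ ≤ t 0}) => ?_
    have h := congrFun hX (consHom μ.1 t μ.2)
    rw [roosCoboundary_apply, Fin.sum_univ_succ] at h
    have h0 : F.map (homOfLE (zero_le_face_zero (consHom μ.1 t μ.2) 0)).op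
        (X (face (consHom μ.1 t μ.2) 0)) = F.map (homOfLE μ.2).op (X t) :=
      map_congr_tuple X (face_consHom_zero μ.1 t μ.2) _ _
    let v : Fin (n + 2) → F.obj (op μ.1) := fun i =>
      X (consHom μ.1 (face t i) (μ.2.trans (zero_le_face_zero t i)))
    have hs : ∀ i : Fin (n + 2), F.map (homOfLE (zero_le_face_zero (consHom μ.1 t μ.2) i.succ)).op
        (X (face (consHom μ.1 t μ.2) i.succ)) = v i := fun i =>
      (map_congr_tuple X (face_consHom_succ μ.1 t μ.2 i) _ le_rfl).trans (map_self_apply _ _)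
    let ev : (coind F).obj (op (t 0)) →+ F.obj (op μ.1) :=
      Pi.evalAddMonoidHom (fun μ : {μ : Λ // μ ≤ t 0} => (F.obj (op μ.1) : Type u)) μ
    have e1 : ev (roosCoboundary (coind F) n y t) = ∑ i : Fin (n + 2), (-1 : ℤ) ^ (i : ℕ) • v i := by
      rw [roosCoboundary_apply, map_sum]
      refine Finset.sum_congr rfl fun i _ => ?_
      rw [map_zsmul]
      rfl
    have h' : F.map (homOfLE μ.2).op (X t) - ev (roosCoboundary (coind F) n y t) = 0 := by
      rw [e1, sub_eq_add_neg, ← Finset.sum_neg_distrib]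
      refine Eq.trans (congrArg₂ (· + ·) (h0.symm.trans (one_smul ℤ _).symm)
        (Finset.sum_congr rfl fun i _ => ?_)) h
      rw [Fin.val_succ, pow_succ, mul_neg_one, neg_smul]
      exact congrArg (fun z => -((-1 : ℤ) ^ (i : ℕ) • z)) (hs i).symm
    exact (sub_eq_zero.1 h').symm
  refine ⟨roosMap r n y, ?_⟩
  rw [roosCoboundary_roosMap, key]
  funext t
  rw [roosMap_apply, roosMap_apply, ← ConcreteCategory.comp_apply, ← NatTrans.comp_app, hr]
  rfl

/-- Dimension shifting: a primitive `y` of `x` has `d y` a cocycle one Roos degree lower and one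
resolution degree higher. Recursion ends in Roos degree `0`, where cocycles are elements of the
limit and `hlim` applies. -/
theorem roos_exact_chase (I : ℕ → Λᵒᵖ ⥤ AddCommGrpCat.{u}) [∀ m, Injective (I m)]
    (d : ∀ m, I m ⟶ I (m + 1)) (hdd : ∀ m, d m ≫ d (m + 1) = 0)
    (hex : ∀ m l (z : (I (m + 1)).obj l), (d (m + 1)).app l z = 0 → ∃ w, (d m).app l w = z)
    {N : ℕ} (hlim : ∀ s : RoosCochain (I (N + 1)) 0, roosCoboundary _ 0 s = 0 →
      roosMap (d (N + 1)) 0 s = 0 → ∃ s' : RoosCochain (I N) 0, roosCoboundary _ 0 s' = 0 ∧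
        roosMap (d N) 0 s' = s) (k m : ℕ) (hkm : k + m = N)
    (x : RoosCochain (I m) (k + 1)) (hx : roosCoboundary _ (k + 1) x = 0)
    (hdx : roosMap (d m) (k + 1) x = 0) :
    ∃ y : RoosCochain (I m) k, roosCoboundary _ k y = x ∧ roosMap (d m) k y = 0 := by
  induction k generalizing m with
  | zero =>
    obtain rfl : m = N := by omega
    obtain ⟨y, rfl⟩ := roos_exact_of_injective (I m) x hx
    obtain ⟨s, hs, hds⟩ := hlim (roosMap (d m) 0 y) (by rw [roosCoboundary_roosMap, hdx])
      (roosMap_roosMap _ _ (hdd m) y)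
    exact ⟨y - s, by rw [map_sub, hs, sub_zero], by rw [map_sub, hds, sub_self]⟩
  | succ k ih =>
    obtain ⟨y, rfl⟩ := roos_exact_of_injective (I m) x hx
    obtain ⟨v, hv, hdv⟩ := ih (m + 1) (by omega) (roosMap (d m) (k + 1) y)
      (by rw [roosCoboundary_roosMap, hdx]) (roosMap_roosMap _ _ (hdd m) y)
    choose v' hv' using fun t => hex m (op (t 0)) (v t) (congrFun hdv t)
    have hv'' : roosMap (d m) k v' = v := funext hv'
    refine ⟨y - roosCoboundary (I m) k v', ?_, ?_⟩
    · rw [map_sub, roosCoboundary_roosCoboundary, sub_zero]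
    · rw [map_sub, ← roosCoboundary_roosMap, hv'', hv, sub_self]

/-- The `0`-cocycles are the elements of the inverse limit. -/
theorem exists_limit_of_roosCoboundary_eq_zero (s : RoosCochain F 0)
    (hs : roosCoboundary F 0 s = 0) :
    ∃ z : (limit F : AddCommGrpCat.{u}), ∀ t : Fin 1 →o Λ, limit.π F (op (t 0)) z = s t := by
  let c : Λ → Fin 1 →o Λ := fun l => ⟨fun _ => l, fun _ _ _ => le_rfl⟩
  have hc : ∀ t : Fin 1 →o Λ, c (t 0) = t := fun t =>
    OrderHom.ext _ _ (funext fun i => by rw [Fin.fin_one_eq_zero i]; rfl)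
  have hcomp : ∀ a b : Λ, ∀ h : a ≤ b, F.map (homOfLE h).op (s (c b)) = s (c a) := by
    intro a b h
    have h1 := congrFun hs (consHom a (c b) h)
    rw [roosCoboundary_apply, Fin.sum_univ_two] at h1
    have e0 : F.map (homOfLE (zero_le_face_zero (consHom a (c b) h) 0)).op
        (s (face (consHom a (c b) h) 0)) = F.map (homOfLE h).op (s (c b)) :=
      map_congr_tuple s (face_consHom_zero a (c b) h) _ _
    have e1 : F.map (homOfLE (zero_le_face_zero (consHom a (c b) h) 1)).op
        (s (face (consHom a (c b) h) 1)) = s (c a) := by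
      refine (map_congr_tuple s (s' := c a) ?_ _ le_rfl).trans (map_self_apply _ _)
      refine OrderHom.ext _ _ (funext fun i => ?_)
      rw [Fin.fin_one_eq_zero i]
      rfl
    have h2 : F.map (homOfLE h).op (s (c b)) - s (c a) = 0 := by
      rw [sub_eq_add_neg]
      refine Eq.trans (congrArg₂ (· + ·) (e0.symm.trans (one_smul ℤ _).symm) ?_) h1
      exact (congrArg (-·) e1.symm).trans (neg_one_zsmul _).symm
    exact sub_eq_zero.1 h2
  -- An element of the limit is obtained from the universal property as a morphism out of `ℤ`,
  -- evaluated at `1`.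
  let φ : AddCommGrpCat.of (ULift.{u} ℤ) ⟶ limit F := limit.lift F
    { pt := AddCommGrpCat.of (ULift.{u} ℤ)
      π :=
        { app := fun l => AddCommGrpCat.ofHom
            (((zmultiplesHom (F.obj l)) (s (c l.unop))).comp AddEquiv.ulift.toAddMonoidHom)
          naturality := fun l l' f => by
            refine AddCommGrpCat.hom_ext (AddMonoidHom.ext fun k => ?_)
            have h := hcomp _ _ (leOfHom f.unop)
            change k.down • s (c l'.unop) = F.map f (k.down • s (c l.unop))
            rw [map_zsmul, ← h]
            rfl } }
  refine ⟨φ ⟨1⟩, fun t => ?_⟩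
  rw [← ConcreteCategory.comp_apply, limit.lift_π]
  change (1 : ℤ) • s (c (t 0)) = s t
  exact (one_smul ℤ _).trans ((map_self_apply le_rfl _).symm.trans
    ((map_congr_tuple s (hc t) le_rfl le_rfl).trans (map_self_apply le_rfl _)))

theorem roosCoboundary_limit (z : (limit F : AddCommGrpCat.{u})) :
    roosCoboundary F 0 (fun t => limit.π F (op (t 0)) z) = 0 := by
  funext t
  rw [roosCoboundary_apply, Fin.sum_univ_two]
  simp only [← ConcreteCategory.comp_apply, limit.w]
  change (-1 : ℤ) ^ 0 • limit.π F (op (t 0)) z + (-1 : ℤ) ^ 1 • limit.π F (op (t 0)) z = 0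
  simp

theorem exists_of_exact_app {S : ShortComplex (Λᵒᵖ ⥤ AddCommGrpCat.{u})} (hS : S.Exact) (l : Λᵒᵖ)
    (z : S.X₂.obj l) (hz : S.g.app l z = 0) : ∃ w : S.X₁.obj l, S.f.app l w = z :=
  (ShortComplex.ab_exact_iff _).1 (hS.map ((evaluation _ _).obj l)) z hz

/-- The cocycle is pushed into the first term of an injective resolution, where the chase yields a
primitive killed by `d 0`; such a primitive comes from `F`. -/
theorem roos_exact_of_isZero_derivedLim (F : Λᵒᵖ ⥤ AddCommGrpCat.{u}) {n : ℕ}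
    (h : IsZero (derivedLim (n + 1) F)) (X : RoosCochain F (n + 1))
    (hX : roosCoboundary F (n + 1) X = 0) : ∃ a, roosCoboundary F n a = X := by
  let J : InjectiveResolution F := InjectiveResolution.of F
  let I : ℕ → Λᵒᵖ ⥤ AddCommGrpCat.{u} := fun m => J.cocomplex.X m
  let d : ∀ m, I m ⟶ I (m + 1) := fun m => J.cocomplex.d m (m + 1)
  have hI : ∀ m, Injective (I m) := fun m => J.injective m
  have hdd : ∀ m, d m ≫ d (m + 1) = 0 := fun m => J.cocomplex.d_comp_d _ _ _
  have hlim : ∀ s : RoosCochain (I (n + 1)) 0, roosCoboundary _ 0 s = 0 →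
      roosMap (d (n + 1)) 0 s = 0 → ∃ s' : RoosCochain (I n) 0, roosCoboundary _ 0 s' = 0 ∧
        roosMap (d n) 0 s' = s := by
    let K := ((lim : (Λᵒᵖ ⥤ AddCommGrpCat.{u}) ⥤ AddCommGrpCat.{u}).mapHomologicalComplex _).obj
      J.cocomplex
    have hK : K.ExactAt (n + 1) := by
      rw [HomologicalComplex.exactAt_iff_isZero_homology]
      exact h.of_iso (J.isoRightDerivedObj lim (n + 1)).symm
    rw [HomologicalComplex.exactAt_iff' _ n (n + 1) (n + 2) (by simp)
      (by simp only [CochainComplex.next]; rfl), ShortComplex.ab_exact_iff] at hK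
    intro s hs hds
    obtain ⟨z, hz⟩ := exists_limit_of_roosCoboundary_eq_zero s hs
    have hz0 : lim.map (d (n + 1)) z = 0 := by
      refine Concrete.limit_ext _ _ _ fun l => ?_
      rw [map_zero, ← ConcreteCategory.comp_apply, lim_map, limMap_π, ConcreteCategory.comp_apply]
      have h1 := hz ⟨fun _ => l.unop, fun _ _ _ => le_rfl⟩
      have h2 := congrFun hds ⟨fun _ => l.unop, fun _ _ _ => le_rfl⟩
      rw [roosMap_apply, ← h1] at h2
      exact h2
    obtain ⟨w, hw⟩ : ∃ w : (limit (I n) : AddCommGrpCat.{u}), lim.map (d n) w = z := hK z hz0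
    refine ⟨fun t => limit.π (I n) (op (t 0)) w, roosCoboundary_limit w, ?_⟩
    funext t
    rw [roosMap_apply, ← hz t, ← hw, ← ConcreteCategory.comp_apply, ← ConcreteCategory.comp_apply,
      lim_map, limMap_π]
  let e := HomologicalComplex.singleObjXSelf (ComplexShape.up ℕ) 0 F
  let ι : F ⟶ I 0 := e.inv ≫ J.ι.f 0
  have hιd : ι ≫ d 0 = 0 := by
    rw [Category.assoc]
    exact (congrArg (e.inv ≫ ·) J.ι_f_zero_comp_complex_d).trans comp_zero
  have hιmono : Mono ι := mono_comp _ _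
  have hιinj : ∀ l, Function.Injective (ι.app l) := fun l => by
    rw [← AddCommGrpCat.mono_iff_injective]
    infer_instance
  have hιex : ∀ l (z : (I 0).obj l), (d 0).app l z = 0 → ∃ w, ι.app l w = z := by
    intro l z hz
    have hS : (ShortComplex.mk (J.ι.f 0) (J.cocomplex.d 0 1) J.ι_f_zero_comp_complex_d).Exact :=
      ShortComplex.exact_of_f_is_kernel _ J.isLimitKernelFork
    obtain ⟨w, hw⟩ := exists_of_exact_app hS l z hz
    refine ⟨e.hom.app l w, ?_⟩
    rw [← hw, ← ConcreteCategory.comp_apply, ← NatTrans.comp_app, e.hom_inv_id_assoc]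
  obtain ⟨y, hy, hdy⟩ := roos_exact_chase I d hdd
    (fun m l z hz => exists_of_exact_app (J.exact_succ m) l z hz) hlim n 0 (by simp)
    (roosMap ι (n + 1) X) (by rw [roosCoboundary_roosMap, hX, map_zero])
    (roosMap_roosMap _ _ hιd X)
  choose a ha using fun t => hιex (op (t 0)) (y t) (congrFun hdy t)
  have ha' : roosMap ι n a = y := funext ha
  refine ⟨a, funext fun t => hιinj (op (t 0)) ?_⟩
  rw [← ha', roosCoboundary_roosMap] at hy
  exact congrFun hy t

end RoosDerived

/-! ### The dominating number -/

section Dominating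

theorem ideal_eq_univ {A : Set BaireMod} (hA : IsCofinal A) : ideal A = Set.univ :=
  Set.eq_univ_of_forall fun f => by
    obtain ⟨a, ha, hfa⟩ := hA f
    exact isLowerSet_ideal A hfa (subset_ideal A ha)

theorem not_isCofinal_of_countable {A : Set BaireMod} (hA : A.Countable) : ¬ IsCofinal A := by
  classical
  intro hcof
  obtain ⟨a₀, ha₀, -⟩ := hcof (fun _ => 0)
  obtain ⟨a, rfl⟩ := hA.exists_eq_range ⟨a₀, ha₀⟩
  let f : BaireMod := fun i => joinF ((Finset.range (i + 1)).image a) i + 1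
  obtain ⟨_, ⟨k, rfl⟩, hk⟩ := hcof f
  have hk' : {i : ℕ | ¬ f i ≤ a k i}.Finite := hk
  refine Set.Ici_infinite k (hk'.subset fun i hi => ?_)
  refine not_le.2 (Nat.lt_succ_of_le (Finset.le_sup (f := fun g : BaireMod => g i) ?_))
  exact Finset.mem_image_of_mem a (Finset.mem_range.2 (Nat.lt_succ_of_le hi))

theorem aleph0_lt_dominatingNumber : ℵ₀ < dominatingNumber := by
  obtain ⟨A, hA, hA'⟩ := Order.exists_cof_eq BaireMod
  rw [dominatingNumber, ← hA', ← not_le, Cardinal.le_aleph0_iff_set_countable]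
  exact fun h => not_isCofinal_of_countable h hA

/-- Functions equal to `f` modulo finite differ from it by a finitely supported integer sequence. -/
theorem countable_equiv_class (f : BaireMod) : {t : BaireMod | t ≤ f ∧ f ≤ t}.Countable := by
  refine (Set.countable_range fun (e : ℕ →₀ ℤ) (i : ℕ) => ((f i : ℤ) + e i).toNat).mono ?_
  rintro t ⟨h1, h2⟩
  have h1' : {i : ℕ | ¬ t i ≤ f i}.Finite := h1
  have h2' : {i : ℕ | ¬ f i ≤ t i}.Finite := h2
  refine ⟨Finsupp.ofSupportFinite (fun i => (t i : ℤ) - f i) ((h1'.union h2').subset ?_), ?_⟩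
  · intro i hi
    by_contra hc
    simp only [Set.mem_union, Set.mem_ofPred_eq, not_or, not_not] at hc
    have : t i = f i := le_antisymm hc.1 hc.2
    simp [this] at hi
  · funext i
    simp [Finsupp.ofSupportFinite_coe]

end Dominating

/-! ### Chains as test sequences -/

section Chain

variable {m : ℕ} {A : Set BaireMod} {s : Wo m → BaireMod}

theorem isTest_singleton (hA : IsCofinal A) (hs : ∀ α β, α ≤ β → s α ≤ s β)
    (hunb : ∀ p, ∃ β, ¬ s β ≤ p) : IsTest (· ≤ ·) A fun β => {s β} where
  countable _ := Set.countable_singleton _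
  nonempty _ := Set.singleton_nonempty _
  subset _ := by
    rw [ideal_eq_univ hA]
    exact Set.subset_univ _
  exists_rel β α h u hu := ⟨s β, rfl, (hs _ _ h.le).trans_eq (Set.mem_singleton_iff.1 hu).symm⟩
  unbounded p _ := by
    obtain ⟨β, hβ⟩ := hunb p
    exact ⟨β, by simpa using hβ⟩

/-- A `≤*`-chain need not be increasing everywhere, but its classes modulo finite are coinitial for
everywhere domination: below `u`, the function `min (s β) u` is still equivalent to `s β`. -/
theorem isTest_equiv_class (hA : IsCofinal A) (hs : ∀ α β, α ≤ β → s α ≤ s β)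
    (hunb : ∀ p, ∃ β, ¬ s β ≤ p) : IsTest DomLE A fun β => {t | t ≤ s β ∧ s β ≤ t} where
  countable _ := countable_equiv_class _
  nonempty β := ⟨s β, le_rfl, le_rfl⟩
  subset _ := by
    rw [ideal_eq_univ hA]
    exact Set.subset_univ _
  exists_rel β α h u hu := by
    have hle : {i : ℕ | ¬ s β i ≤ u i}.Finite := (hs _ _ h.le).trans hu.2
    refine ⟨fun i => min (s β i) (u i), ⟨finerOrder_domLE.le _ _ fun i => min_le_left _ _, ?_⟩,
      fun i => min_le_right _ _⟩
    exact hle.subset fun i hi hi' => hi (le_min le_rfl hi')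
  unbounded p _ := by
    obtain ⟨β, hβ⟩ := hunb p
    exact ⟨β, fun t ht htp => hβ (ht.2.trans htp)⟩

end Chain

/-! ### Characters -/

section Character

instance : Countable (AddCircle (1 : ℚ)) := (QuotientAddGroup.mk_surjective).countable

/-- This replaces an arbitrary `G` by a countable target, as the coding in the weak diamond
requires. -/
theorem exists_character_ne_zero (G : Type*) [AddCommGroup G] [Nontrivial G] :
    ∃ φ : G →+ AddCircle (1 : ℚ), φ ≠ 0 := by
  obtain ⟨a, ha⟩ := exists_ne (0 : G)
  obtain ⟨c, hc⟩ := CharacterModule.exists_character_apply_ne_zero_of_ne_zero ha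
  exact ⟨c, fun h => hc (DFunLike.congr_fun h a)⟩

end Character

theorem isCoherent_toFamily {G : Type u} [AddCommGroup G] {m : ℕ} {x : Coch G (m + 1)}
    (hx : EqMod (· ≤ ·) Set.univ (dl x) 0) :
    IsCoherent (n := m + 1) (show Family G Set.univ (m + 1) from x.toFamily Set.univ) := by
  have hrep : Represents x (x.toFamily Set.univ) := fun _ => rfl
  refine funext fun t => (hrep.roosCoboundary t).trans (classOf_eq_zero.2 ?_)
  have h := hx _ (tup_orderHom t)
  rwa [Pi.zero_apply, sub_zero] at h

end NonvanishingLim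

theorem mainTheorem3 (n : ℕ)
    (hd : NonvanishingLim.dominatingNumber = ℵ_ (n : Ordinal.{0}))
    (C : Set NonvanishingLim.BaireMod)
    (hC : NonvanishingLim.IsOrdinalChain (ω_ (n : Ordinal.{0})) C)
    (hCunb : ¬ BddAbove C)
    (hdiamond : ∀ k < n, NonvanishingLim.WeakDiamond (NonvanishingLim.cofSet k))
    (hcard : (2 : Cardinal.{0}) ^ ℵ_ (0 : Ordinal.{0}) < 2 ^ ℵ_ (1 : Ordinal.{0}))
    (G : Type u) [AddCommGroup G] [Nontrivial G] :
    (∃ x : NonvanishingLim.Family G Set.univ n,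
      NonvanishingLim.IsCoherent x ∧
        ¬ NonvanishingLim.IsTrivial (NonvanishingLim.restrict (Set.subset_univ C) x)) ∧
      ¬ IsZero (NonvanishingLim.derivedLim n (NonvanishingLim.ASystem G)) := by
  open NonvanishingLim in
  cases n with
  | zero =>
    rw [Nat.cast_zero, Cardinal.aleph_zero] at hd
    exact absurd hd aleph0_lt_dominatingNumber.ne'
  | succ m =>
    obtain ⟨A, hA, hA'⟩ := Order.exists_cof_eq BaireMod
    have hAm : CardLE (m + 1) A := (hA'.trans hd).le
    rw [Nat.cast_succ] at hC
    obtain ⟨σ, hσ⟩ := hC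
    let s : Wo m → BaireMod := fun α => σ α
    have hs : ∀ α β, α ≤ β → s α ≤ s β := hσ
    have hunb : ∀ p, ∃ β, ¬ s β ≤ p := by
      intro p
      by_contra! h
      refine hCunb ⟨p, fun f hf => ?_⟩
      have h1 := h (σ.symm ⟨f, hf⟩)
      rwa [show s (σ.symm ⟨f, hf⟩) = f from congrArg Subtype.val (σ.apply_symm_apply ⟨f, hf⟩)] at h1
    obtain ⟨φ, hφ⟩ := exists_character_ne_zero G
    have hw : ∀ k ≤ m, WeakDiamond (cofSet k) := fun k hk => hdiamond k (Nat.lt_succ_of_le hk)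
    constructor
    -- A trivialization over `G` on `C` would map under `φ` to one over the character's target.
    · obtain ⟨x, hx, hx'⟩ := nonvanishing ⟨le_refl, fun _ _ _ => le_trans, fun _ _ h => h⟩ hφ hw A _
        hAm (isTest_singleton hA hs hunb)
      rw [ideal_eq_univ hA] at hx
      refine ⟨x.toFamily Set.univ, isCoherent_toFamily hx, fun h => hx' ?_⟩
      obtain ⟨y, hy⟩ := exists_eqMod_of_isTrivial h
      refine ⟨Coch.map φ y, ?_⟩
      rw [← Coch.map_dl]
      refine (hy.map φ).mono (Set.iUnion_subset fun β => ?_)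
      exact Set.singleton_subset_iff.2 (σ β).2
    · intro h0
      -- This family is nontrivial on tuples increasing everywhere, which is the form that exactness
      -- for `𝐀_G` contradicts.
      obtain ⟨x, hx, hx'⟩ := nonvanishing finerOrder_domLE hφ hw A _ hAm
        (isTest_equiv_class hA hs hunb)
      rw [ideal_eq_univ hA] at hx
      obtain ⟨b, hb⟩ := exists_eqMod_of_roos_exact (roos_exact_of_isZero_derivedLim _ h0) hx
      refine hx' ⟨Coch.map φ b, ?_⟩
      rw [← Coch.map_dl]
      exact (hb.map φ).mono (Set.subset_univ _)
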